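/- **Definitions.** A *capacitated selfish replication (CSR) game* has a finite set of players $1,\dots,n$ and a server, together the set $V$ of nodes, and a set $\mathcal O$ of objects. A *placement* $P$ assigns to each player $i$ the one object $P_i\in\mathcal O$ stored at $i$; the server stores every object. Each player $i$ has a total preorder $\succeq_i$ on $V$ with $i\succeq_i j$ for all $j\in V$, and a total preorder on the placements (written $\succeq_i$ too, with strict part $\succ_i$), such that - (Monotonicity) if for every object $\alpha$ and every node $q$ holding $\alpha$ in $Q$ there is a node $p$ holding $\alpha$ in $P$ with $p\succeq_i q$, then $P\succeq_i Q$; - (Consistency) if for each $\alpha\in\{P_i,Q_i\}$ the most $i$-preferred nodes of $V\setminus\{i\}$ holding $\alpha$ in $P$ and in $Q$ are equally $i$-preferred, and $(P_i,P_{-i})\succ_i(Q_i,P_{-i})$, then $(P_i,Q_{-i})\succeq_i(Q_i,Q_{-i})$. The game has *binary preferences* if each player $i$ has a set $S_i\subseteq\mathcal O$ such that, for placements $P,Q$ with $P_{-i}=Q_{-i}$, $P\succeq_i Q$ holds if and only if, for every $1\le k\le|S_i|$, the $k$-th term of $\tau_i(P)$ is at least as $i$-preferred as the $k$-th term of $\tau_i(Q)$;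 here $\tau_i(P)$ lists, from most to least $i$-preferred, the most $i$-preferred nodes holding $\alpha$ in $P$, for $\alpha\in S_i$. An *equilibrium* is a placement $P$ such that there are no player $i$ and object $\alpha$ with $(\alpha,P_{-i})\succ_i P$. - **2BIN**: given a CSR game with two objects and binary preferences (specified by the sets $S_i$ and by the bit matrices of the relations $\succeq_i$ on $V$), does it have an equilibrium? - **EVEN-CYCLE**: given a finite digraph (by its adjacency matrix), does it contain a directed cycle (without repeated vertices) of even length? A digraph $D$ on the players is *stable* if the CSR game on it, with two objects, binary preferences, $S_i=\mathcal O$ for all $i$, and $j\succeq_i k$ if and only if $\operatorname{dist}_D(i,j)\le\operatorname{dist}_D(i,k)$ (the server being at distance $\infty$ from every player), has an equilibrium. **Theorem.** EVEN-CYCLE and 2BIN are polynomial-time equivalent: each of the two problems can be decided in polynomial time with an oracle for the other. Moreover, a strongly connected digraph with at least two vertices is stable if and only if it contains an even cycle. -/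

import Mathlib

/-! ### A programming language with an oracle and a cost measure

Inputs and values are binary trees.  A program maps trees to trees; `ask` submits its argument to an
oracle.  Every construct charges at least the size of the tree it is applied to (so copying a tree
costs its size, and a query costs the size of the queried tree), on top of the costs of its parts.
Up to polynomials, this is the running time of a deterministic Turing machine with an oracle. -/

/-- Binary trees. -/
inductive Data : Type
  | nil : Data
  | cons : Data → Data → Data

namespace Data

/-- The number of nodes (inner nodes and leaves) of a tree. -/
def size : Data → ℕ
  | nil => 1
  | cons a b => a.size + b.size + 1

/-- Left subtree. -/
def head : Data → Data
  | nil => nil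
  | cons a _ => a

/-- Right subtree. -/
def tail : Data → Data
  | nil => nil
  | cons _ b => b

/-- Truth values: `nil` is false, every other tree counts as true. -/
def ofBool : Bool → Data
  | false => nil
  | true => cons nil nil

/-- Lists as trees, in the usual right-nested way. -/
def ofList : List Data → Data
  | [] => nil
  | a :: l => cons a (ofList l)

end Data

/-- Programs of the language; each denotes a partial function from trees to trees. -/
inductive Prog : Type
  /-- the constant `nil` -/
  | nil : Prog
  /-- the identity -/
  | id : Prog
  /-- the left subtree -/
  | head : Prog
  /-- the right subtree -/
  | tail : Prog
  /-- run both programs on the input and join the results -/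
  | cons : Prog → Prog → Prog
  /-- `seq f g`: run `f`, then run `g` on its result -/
  | seq : Prog → Prog → Prog
  /-- `ite c f g`: run `c` on the input; on the input, run `f` if the result was true, else `g` -/
  | ite : Prog → Prog → Prog → Prog
  /-- `loop c f`: while `c` is true of the current value, replace the value by its image under `f` -/
  | loop : Prog → Prog → Prog
  /-- ask the oracle about the input -/
  | ask : Prog

/-- `Prog.Run A p x y t`: with the oracle that decides membership in `A`, program `p` halts on
input `x` with output `y` and total cost `t`. -/
inductive Prog.Run (A : Set Data) : Prog → Data → Data → ℕ → Prop
  | nil (x : Data) : Run A .nil x .nil x.size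
  | id (x : Data) : Run A .id x x x.size
  | head (x : Data) : Run A .head x x.head x.size
  | tail (x : Data) : Run A .tail x x.tail x.size
  | cons {f g : Prog} {x y z : Data} {s t : ℕ} (hf : Run A f x y s) (hg : Run A g x z t) :
      Run A (.cons f g) x (.cons y z) (x.size + s + t)
  | seq {f g : Prog} {x y z : Data} {s t : ℕ} (hf : Run A f x y s) (hg : Run A g y z t) :
      Run A (.seq f g) x z (x.size + s + t)
  | ite_true {c f g : Prog} {x b y : Data} {s t : ℕ} (hc : Run A c x b s) (hb : b ≠ .nil)
      (hf : Run A f x y t) : Run A (.ite c f g) x y (x.size + s + t)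
  | ite_false {c f g : Prog} {x y : Data} {s t : ℕ} (hc : Run A c x .nil s)
      (hg : Run A g x y t) : Run A (.ite c f g) x y (x.size + s + t)
  | loop_done {c f : Prog} {x : Data} {s : ℕ} (hc : Run A c x .nil s) :
      Run A (.loop c f) x x (x.size + s)
  | loop_step {c f : Prog} {x b y z : Data} {s t u : ℕ} (hc : Run A c x b s) (hb : b ≠ .nil)
      (hf : Run A f x y t) (hl : Run A (.loop c f) y z u) :
      Run A (.loop c f) x z (x.size + s + t + u)
  | ask_yes {x : Data} (hx : x ∈ A) : Run A .ask x (.ofBool true) x.size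
  | ask_no {x : Data} (hx : x ∉ A) : Run A .ask x (.ofBool false) x.size

/-! ### Decision problems and polynomial-time equivalence -/

/-- A decision problem: a set of instances, their encodings as inputs, and the yes-instances. -/
structure DecisionProblem where
  Instance : Type
  encode : Instance → Data
  Yes : Instance → Prop

namespace DecisionProblem

/-- The encodings of the yes-instances. -/
def language (A : DecisionProblem) : Set Data :=
  {d | ∃ I : A.Instance, A.encode I = d ∧ A.Yes I}

/-- Polynomial-time (Turing) reducibility: some program decides `A` with an oracle for `B`,
at a cost that is polynomial in the size of the encoded instance. -/
def PolyTimeReducible (A B : DecisionProblem) : Prop :=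
  ∃ (p : Prog) (q : Polynomial ℕ), ∀ I : A.Instance, ∃ (y : Data) (t : ℕ),
    Prog.Run B.language p (A.encode I) y t ∧ t ≤ q.eval (A.encode I).size ∧
      (y ≠ Data.nil ↔ A.Yes I)

/-- Polynomial-time equivalence. -/
def PolyTimeEquivalent (A B : DecisionProblem) : Prop :=
  A.PolyTimeReducible B ∧ B.PolyTimeReducible A

end DecisionProblem

/-! ### Digraphs and even cycles -/

/-- A directed cycle (no repeated vertex) of positive even length. -/
def HasEvenCycle {V : Type} (G : Digraph V) : Prop :=
  ∃ k : ℕ, 0 < k ∧ Even k ∧ ∃ c : ZMod k → V, Function.Injective c ∧ ∀ i, G.Adj (c i) (c (i + 1))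

/-- There is a directed path from every vertex to every vertex. -/
def StronglyConnected {V : Type} (G : Digraph V) : Prop :=
  ∀ u v : V, Relation.ReflTransGen G.Adj u v

/-- The least number of arcs of a directed walk from `u` to `v`, infinite if there is none. -/
noncomputable def digraphDist {V : Type} (G : Digraph V) (u v : V) : ℕ∞ :=
  sInf {d : ℕ∞ | ∃ (k : ℕ) (w : ℕ → V), w 0 = u ∧ w k = v ∧
    (∀ j, j < k → G.Adj (w j) (w (j + 1))) ∧ d = k}

open Classical in
/-- The encoding of a digraph by the rows of its adjacency matrix. -/
noncomputable def encodeDigraph {n : ℕ} (G : Digraph (Fin n)) : Data :=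
  Data.ofList (List.ofFn fun i => Data.ofList (List.ofFn fun j => Data.ofBool (decide (G.Adj i j))))

/-- Does a given digraph contain an even cycle? -/
noncomputable def EvenCycle : DecisionProblem where
  Instance := Σ n : ℕ, Digraph (Fin n)
  encode G := encodeDigraph G.2
  Yes G := HasEvenCycle G.2

/-! ### Capacitated selfish replication games -/

/-- The nodes of a network: the players `some i`, and the server `none`, which stores every
object. -/
abbrev Node (n : ℕ) : Type := Option (Fin n)

/-- A global placement: each player's cache holds exactly one object. -/
abbrev Placement (n : ℕ) (O : Type) : Type := Fin n → O

/-- Node `v` holds object `a` in the placement `P`. -/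
def Holds {n : ℕ} {O : Type} (P : Placement n O) (v : Node n) (a : O) : Prop :=
  ∀ j : Fin n, v = some j → P j = a

/-- For a preference order `r` among nodes, `v` is a most preferred node in `W` that holds `a`. -/
def IsMostPreferredHolder {n : ℕ} {O : Type} (r : Node n → Node n → Prop) (W : Set (Node n))
    (P : Placement n O) (a : O) (v : Node n) : Prop :=
  v ∈ W ∧ Holds P v a ∧ ∀ w ∈ W, Holds P w a → r v w

/-- A CSR game with `n` players (of unit cache capacity) and objects `O`.
`nodePref i j k` says that player `i` likes node `j` at least as much as node `k`;
`utilPref i P Q` says that player `i` likes placement `P` at least as much as placement `Q`. -/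
structure CSRGame (n : ℕ) (O : Type) where
  nodePref : Fin n → Node n → Node n → Prop
  nodePref_total : ∀ i j k, nodePref i j k ∨ nodePref i k j
  nodePref_trans : ∀ i j k l, nodePref i j k → nodePref i k l → nodePref i j l
  nodePref_self : ∀ i j, nodePref i (some i) j
  utilPref : Fin n → Placement n O → Placement n O → Prop
  utilPref_total : ∀ i P Q, utilPref i P Q ∨ utilPref i Q P
  utilPref_trans : ∀ i P Q R, utilPref i P Q → utilPref i Q R → utilPref i P R
  monotonicity : ∀ i P Q,
    (∀ a q, Holds Q q a → ∃ p, Holds P p a ∧ nodePref i p q) → utilPref i P Q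
  consistency : ∀ i P Q,
    (∀ a, a = P i ∨ a = Q i → ∀ p q,
      IsMostPreferredHolder (nodePref i) {v | v ≠ some i} P a p →
      IsMostPreferredHolder (nodePref i) {v | v ≠ some i} Q a q →
      nodePref i p q ∧ nodePref i q p) →
    ¬ utilPref i (Function.update P i (Q i)) P → utilPref i (Function.update Q i (P i)) Q

namespace CSRGame

variable {n : ℕ} {O : Type} (G : CSRGame n O)

/-- Player `i` plays a best response in `P`. -/
def IsStableAt (P : Placement n O) (i : Fin n) : Prop :=
  ∀ a : O, G.utilPref i P (Function.update P i a)

/-- A pure Nash equilibrium. -/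
def IsEquilibrium (P : Placement n O) : Prop :=
  ∀ i, G.IsStableAt P i

/-- `τ` lists, from most to least `i`-preferred, the most `i`-preferred holders of the objects
in `S`. -/
def IsAccessSequence (i : Fin n) (S : Finset O) (P : Placement n O) (τ : Fin S.card → Node n) :
    Prop :=
  (∃ e : Fin S.card ≃ S, ∀ k, IsMostPreferredHolder (G.nodePref i) Set.univ P (e k) (τ k)) ∧
    ∀ k l, k ≤ l → G.nodePref i (τ k) (τ l)

/-- Binary object preferences with interest sets `S`: between two placements that differ only at
player `i`, it is the termwise comparison of the access sequences of the objects in `S i` that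
determines what `i` prefers. -/
def HasBinaryPreferences (S : Fin n → Finset O) : Prop :=
  ∀ i P Q, (∀ j, j ≠ i → P j = Q j) →
    (G.utilPref i P Q ↔ ∀ τ τ', G.IsAccessSequence i (S i) P τ → G.IsAccessSequence i (S i) Q τ' →
      ∀ k, G.nodePref i (τ k) (τ' k))

end CSRGame

/-- A CSR game with two objects and binary object preferences. -/
structure BinaryTwoObjectGame where
  n : ℕ
  game : CSRGame n Bool
  interest : Fin n → Finset Bool
  binary : game.HasBinaryPreferences interest

namespace BinaryTwoObjectGame

open Classical in
/-- The encoding lists, for each player, the two bits of the interest set and the bit matrix of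
the node preference relation; they determine all utility comparisons that a player makes. -/
noncomputable def encode (I : BinaryTwoObjectGame) : Data :=
  Data.ofList (List.ofFn fun i : Fin I.n =>
    Data.cons
      (Data.cons (Data.ofBool (decide (false ∈ I.interest i)))
        (Data.ofBool (decide (true ∈ I.interest i))))
      (Data.ofList ((none :: List.ofFn some).map fun j : Node I.n =>
        Data.ofList ((none :: List.ofFn some).map fun k : Node I.n =>
          Data.ofBool (decide (I.game.nodePref i j k))))))

/-- The game has an equilibrium. -/
def HasEquilibrium (I : BinaryTwoObjectGame) : Prop :=
  ∃ P, I.game.IsEquilibrium P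

end BinaryTwoObjectGame

/-- Does a given CSR game with two objects and binary preferences have an equilibrium? -/
noncomputable def TwoBin : DecisionProblem where
  Instance := BinaryTwoObjectGame
  encode := BinaryTwoObjectGame.encode
  Yes := BinaryTwoObjectGame.HasEquilibrium

/-! ### The games given by a digraph -/

/-- The distance from a player to a node; the server is infinitely far away. -/
noncomputable def nodeDist {n : ℕ} (D : Digraph (Fin n)) (i : Fin n) (v : Node n) : ℕ∞ :=
  v.elim ⊤ (digraphDist D i)

/-- `I` is the game on the digraph `D`: nearer nodes are preferred, and every player is
interested in both objects. -/
def BinaryTwoObjectGame.IsGameOn (I : BinaryTwoObjectGame) (D : Digraph (Fin I.n)) : Prop :=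
  (∀ i j k, I.game.nodePref i j k ↔ nodeDist D i j ≤ nodeDist D i k) ∧
    ∀ i, I.interest i = Finset.univ

/-- The digraph is stable: some placement makes every node of the game on it stable. -/
def StableDigraph {n : ℕ} (D : Digraph (Fin n)) : Prop :=
  ∃ (G : CSRGame n Bool) (S : Fin n → Finset Bool) (h : G.HasBinaryPreferences S),
    BinaryTwoObjectGame.IsGameOn ⟨n, G, S, h⟩ D ∧ ∃ P, G.IsEquilibrium P

/-! ### Even cycles and two-colourings of digraphs -/

/-! A player interested in both objects plays a best response exactly when one of its most preferred
other nodes holds the object that it does not store itself. The server stores everything, so a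
player for whom nothing beats the server is always content; a player interested in at most one
object can be satisfied by its own choice. Apart from these free players, an equilibrium is
therefore a two-colouring of the nearest-node digraph in which every player has an out-neighbour of
the other colour.

Such a colouring exists if and only if every vertex reaches a free player or an even cycle. Given a
colouring, follow arcs that change the colour: the walk hits a free player or closes up to an
alternating, hence even, cycle (`reaches_of_coloring`). Conversely, colour the free players suitably
and disjoint even cycles alternately, and extend backwards along arcs (`exists_coloring`). This
gives `CSRGame.HasBinaryPreferences.exists_isEquilibrium_iff`.

To decide 2BIN, compute for each player the set of players reachable from it, look for a free player
in this set, and otherwise ask whether the arcs starting in it contain an even cycle. To decide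
EVEN-CYCLE, take for each vertex `v` the set `B` of vertices that reach `v`, and let the members of
`B` want both objects and like their out-neighbours in `B` best, all others being free. If `v` lies
on a closed walk through another vertex, then no member of `B` is free and an equilibrium forces an
even cycle (`hasEvenCycle_of_targetGame`); if `v` lies on an even cycle, there is an equilibrium
(`targetGame_of_cycle`). That the required games exist is `CSRGame.exists_game`. Both procedures are
polynomial because polynomial-time functions are closed under composition and suitably bounded
iteration.

In a strongly connected digraph with at least two vertices, the nearest-node digraph is the digraph
without its loops and nobody is free, so the criterion reduces to the existence of an even cycle. -/

/-- Some vertex of an even cycle of `G` is reachable from `v`. -/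
def ReachesEvenCycle {V : Type} (G : Digraph V) (v : V) : Prop :=
  ∃ k : ℕ, 0 < k ∧ Even k ∧ ∃ c : ZMod k → V, Function.Injective c ∧
    (∀ i, G.Adj (c i) (c (i + 1))) ∧ Relation.ReflTransGen G.Adj v (c 0)

/-- All vertices of a cycle are reachable from its base point. -/
theorem reflTransGen_cycle {V : Type} {r : V → V → Prop} {k : ℕ} (hk : 0 < k) {c : ZMod k → V}
    (h : ∀ i, r (c i) (c (i + 1))) (i j : ZMod k) : Relation.ReflTransGen r (c i) (c j) := by
  have : NeZero k := ⟨hk.ne'⟩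
  have key : ∀ m : ℕ, Relation.ReflTransGen r (c i) (c (i + m)) := by
    intro m
    induction m with
    | zero => simpa using Relation.ReflTransGen.refl
    | succ m ih =>
      refine ih.tail ?_
      have := h (i + m)
      rwa [add_assoc, ← Nat.cast_succ] at this
  have := key (j - i).val
  rwa [ZMod.natCast_zmod_val, add_sub_cancel] at this

/-- In a finite digraph, a colour-alternating infinite orbit runs into an even cycle. -/
theorem reachesEvenCycle_of_alternating {V : Type} [Finite V] {G : Digraph V} (P : V → Bool)
    (f : V → V) (v : V) (hadj : ∀ m, G.Adj (f^[m] v) (f (f^[m] v)))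
    (hP : ∀ m, P (f (f^[m] v)) ≠ P (f^[m] v)) : ReachesEvenCycle G v := by
  have hreach : ∀ m, Relation.ReflTransGen G.Adj v (f^[m] v) := by
    intro m
    induction m with
    | zero => exact .refl
    | succ m ih => rw [Function.iterate_succ_apply']; exact ih.tail (hadj m)
  obtain ⟨a, b, hab, heq⟩ : ∃ a b : ℕ, a < b ∧ f^[a] v = f^[b] v := by
    obtain ⟨a, b, hne, h⟩ := Finite.exists_ne_map_eq_of_infinite fun m : ℕ => f^[m] v
    rcases lt_or_gt_of_ne hne with h' | h'
    · exact ⟨a, b, h', h⟩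
    · exact ⟨b, a, h', h.symm⟩
  set x := f^[a] v with hx
  have hit : ∀ m, f^[m] x = f^[m + a] v := fun m => by rw [hx, Function.iterate_add_apply]
  have hper : Function.IsPeriodicPt f (b - a) x := by
    rw [Function.IsPeriodicPt, Function.IsFixedPt, hit, Nat.sub_add_cancel hab.le, ← heq]
  -- The orbit is only eventually periodic: `x` is a point on its periodic part, and taking the
  -- minimal period makes the cycle injective.
  set k := Function.minimalPeriod f x with hk
  have hk0 : 0 < k := hper.minimalPeriod_pos (Nat.sub_pos_of_lt hab)
  have : NeZero k := ⟨hk0.ne'⟩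
  have hcol : ∀ m, P (f^[m] x) = (P x).xor (decide (Odd m)) := by
    intro m
    induction m with
    | zero => simp
    | succ m ih =>
      have h1 : P (f^[m + 1] x) ≠ P (f^[m] x) := by
        rw [Function.iterate_succ_apply', hit]; exact hP _
      have h2 : P (f^[m + 1] x) = !P (f^[m] x) := Bool.eq_not_of_ne h1
      rw [h2, ih]
      by_cases hm : Odd m
      · have : ¬ Odd (m + 1) := by simpa using hm.add_one
        simp [hm, this]
      · have : Odd (m + 1) := (Nat.not_odd_iff_even.1 hm).add_one
        simp [hm, this]
  -- After `k` steps the orbit is back at `x` with the same colour, while each step flips the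
  -- colour.
  have heven : Even k := by
    have h := hcol k
    rw [hk, Function.iterate_minimalPeriod] at h
    by_contra ho
    rw [Nat.not_even_iff_odd, hk] at ho
    simp [ho] at h
  refine ⟨k, hk0, heven, fun j => f^[j.val] x, ?_, ?_, ?_⟩
  · intro i j hij
    exact ZMod.val_injective k
      (Function.iterate_injOn_Iio_minimalPeriod (ZMod.val_lt i) (ZMod.val_lt j) hij)
  · intro i
    have : f^[(i + 1).val] x = f (f^[i.val] x) := by
      rw [← Function.iterate_succ_apply' f, ZMod.val_add, ZMod.val_one_eq_one_mod,
        Nat.add_mod_mod]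
      exact Function.iterate_mod_minimalPeriod_eq
    dsimp only
    rw [this, hit]
    exact hadj _
  · simpa [hx] using hreach a

/-- The vertices of an even cycle can be coloured alternately. -/
theorem exists_alternating_extend {V : Type} {G : Digraph V} {k : ℕ} (he : Even k)
    {c : ZMod k → V} (hc : Function.Injective c) (ha : ∀ i, G.Adj (c i) (c (i + 1)))
    (P : V → Bool) : ∃ Q : V → Bool, (∀ v, v ∉ Set.range c → Q v = P v) ∧
      ∀ v ∈ Set.range c, ∃ w ∈ Set.range c, G.Adj v w ∧ Q w ≠ Q v := by
  -- Parity is well defined modulo the even number `k`, so that colouring by parity also alternates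
  -- where the cycle closes.
  let φ := ZMod.castHom he.two_dvd (ZMod 2)
  refine ⟨Function.extend c (fun j => decide (φ j = 0)) P, ?_, ?_⟩
  · intro v hv
    exact Function.extend_apply' _ _ _ hv
  · rintro _ ⟨j, rfl⟩
    refine ⟨c (j + 1), ⟨_, rfl⟩, ha j, ?_⟩
    rw [hc.extend_apply, hc.extend_apply, map_add, map_one]
    generalize φ j = z
    revert z
    decide

/-- Two-colourings with prescribed colours on `F` such that all other vertices have an
out-neighbour of the other colour exist as soon as every vertex reaches `F` or an even cycle. -/
theorem exists_coloring {V : Type} [Finite V] (G : Digraph V) (F : Set V) (b : V → Bool)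
    (h : ∀ v, (∃ w ∈ F, Relation.ReflTransGen G.Adj v w) ∨ ReachesEvenCycle G v) :
    ∃ P : V → Bool, (∀ v ∈ F, P v = b v) ∧ ∀ v ∉ F, ∃ w, G.Adj v w ∧ P w ≠ P v := by
  classical
  -- Partial solutions: sets `X` whose vertices outside `F` find an out-neighbour of the other
  -- colour within `X`. A maximal one is shown to contain every vertex.
  let good : Set (Set V) := {X | F ⊆ X ∧ ∃ P : V → Bool, (∀ v ∈ F, P v = b v) ∧
    ∀ v ∈ X, v ∉ F → ∃ w ∈ X, G.Adj v w ∧ P w ≠ P v}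
  obtain ⟨X, hX⟩ : ∃ X, Maximal (· ∈ good) X :=
    (Set.toFinite good).exists_maximal ⟨F, subset_rfl, b, fun _ _ => rfl, fun v h h' => (h' h).elim⟩
  obtain ⟨⟨hFX, P, hPb, hP⟩, hmax⟩ := hX
  -- A vertex with an arc into `X` can be added, with the colour opposite to that of the head of the
  -- arc.
  have step : ∀ u w, G.Adj u w → w ∈ X → u ∈ X := by
    intro u w huw hw
    by_contra hu
    have hmem : insert u X ∈ good := by
      refine ⟨hFX.trans (Set.subset_insert _ _), Function.update P u (!P w), ?_, ?_⟩
      · intro v hv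
        rw [Function.update_of_ne (fun hvu => hu (by rw [← hvu]; exact hFX hv)), hPb v hv]
      · intro v hv hvF
        rcases Set.mem_insert_iff.1 hv with rfl | hv
        · refine ⟨w, Set.mem_insert_of_mem _ hw, huw, ?_⟩
          have : w ≠ v := fun h => hu (h ▸ hw)
          simp [Function.update_of_ne this]
        · obtain ⟨z, hz, hvz, hne⟩ := hP v hv hvF
          refine ⟨z, Set.mem_insert_of_mem _ hz, hvz, ?_⟩
          rwa [Function.update_of_ne (ne_of_mem_of_not_mem hz hu),
            Function.update_of_ne (ne_of_mem_of_not_mem hv hu)]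
    exact hu (hmax hmem (Set.subset_insert _ _) (Set.mem_insert _ _))
  have reach : ∀ u w, Relation.ReflTransGen G.Adj u w → w ∈ X → u ∈ X := by
    intro u w huw hw
    induction huw using Relation.ReflTransGen.head_induction_on with
    | refl => exact hw
    | head h _ ih => exact step _ _ h ih
  have hall : ∀ v, v ∈ X := by
    intro v
    rcases h v with ⟨w, hw, hr⟩ | ⟨k, hk, he, c, hc, ha, hr⟩
    · exact reach _ _ hr (hFX hw)
    · refine reach _ _ hr ?_
      by_contra h0
      -- Since `X` is closed under predecessors, a cycle that is not inside `X` avoids it, and can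
      -- be recoloured without disturbing `X`.
      have hdisj : ∀ j, c j ∉ X := fun j hj => h0 (reach _ _ (reflTransGen_cycle hk ha 0 j) hj)
      obtain ⟨Q, hQ, hQc⟩ := exists_alternating_extend he hc ha P
      have hQX : ∀ v ∈ X, Q v = P v := fun v hv => hQ v (by rintro ⟨j, rfl⟩; exact hdisj j hv)
      have hmem : X ∪ Set.range c ∈ good := by
        refine ⟨hFX.trans Set.subset_union_left, Q, fun v hv => ?_, ?_⟩
        · rw [hQX v (hFX hv), hPb v hv]
        · rintro v (hv | hv) hvF
          · obtain ⟨z, hz, hvz, hne⟩ := hP v hv hvF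
            exact ⟨z, Or.inl hz, hvz, by rwa [hQX z hz, hQX v hv]⟩
          · obtain ⟨z, hz, hvz, hne⟩ := hQc v hv
            exact ⟨z, Or.inr hz, hvz, hne⟩
      exact h0 (hmax hmem Set.subset_union_left (Or.inr ⟨0, rfl⟩))
  exact ⟨P, hPb, fun v hv => by
    obtain ⟨w, -, hw⟩ := hP v (hall v) hv
    exact ⟨w, hw⟩⟩

/-- If all vertices outside `F` have an out-neighbour of the other colour, then every vertex
reaches `F` or an even cycle. -/
theorem reaches_of_coloring {V : Type} [Finite V] (G : Digraph V) (F : Set V) (P : V → Bool)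
    (hP : ∀ v ∉ F, ∃ w, G.Adj v w ∧ P w ≠ P v) (v : V) :
    (∃ w ∈ F, Relation.ReflTransGen G.Adj v w) ∨ ReachesEvenCycle G v := by
  classical
  by_cases h : ∃ w ∈ F, Relation.ReflTransGen G.Adj v w
  · exact Or.inl h
  refine Or.inr ?_
  -- Vertices of `F` get themselves as a dummy successor; the orbit of `v` never meets them.
  have hP' : ∀ u, ∃ w, u ∉ F → G.Adj u w ∧ P w ≠ P u := fun u => by
    by_cases hu : u ∈ F
    · exact ⟨u, fun h => (h hu).elim⟩
    · obtain ⟨w, hw⟩ := hP u hu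
      exact ⟨w, fun _ => hw⟩
  choose f hf using hP'
  have hreach : ∀ m, Relation.ReflTransGen G.Adj v (f^[m] v) := by
    intro m
    induction m with
    | zero => exact .refl
    | succ m ih =>
      rw [Function.iterate_succ_apply']
      exact ih.tail (hf _ fun hF => h ⟨_, hF, ih⟩).1
  have hnF : ∀ m, f^[m] v ∉ F := fun m hF => h ⟨_, hF, hreach m⟩
  exact reachesEvenCycle_of_alternating P f v (fun m => (hf _ (hnF m)).1) fun m => (hf _ (hnF m)).2

/-! ### Best responses in games with two objects and binary preferences -/

/-- Player `i`'s most preferred other players. -/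
def nearestDigraph {n : ℕ} (r : Fin n → Node n → Node n → Prop) : Digraph (Fin n) where
  Adj i j := j ≠ i ∧ ∀ w, w ≠ some i → r i (some j) w

/-- The players that are stable in every placement, or can be made so by a suitable choice of their
own object: those not interested in both objects, and those for whom nothing beats the server. -/
def freePlayers {n : ℕ} (r : Fin n → Node n → Node n → Prop) (S : Fin n → Finset Bool) :
    Set (Fin n) :=
  {i | S i ≠ Finset.univ ∨ ∀ w, w ≠ some i → r i none w}

theorem holds_none {n : ℕ} {O : Type} (P : Placement n O) (a : O) : Holds P none a := by
  intro j h
  cases h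

theorem holds_some {n : ℕ} {O : Type} {P : Placement n O} {i : Fin n} {a : O} :
    Holds P (some i) a ↔ P i = a := by
  constructor
  · intro h
    exact h i rfl
  · intro h j hj
    cases hj
    exact h

theorem holds_update {n : ℕ} {O : Type} (P : Placement n O) (i : Fin n) (b : O)
    {v : Node n} (hv : v ≠ some i) (a : O) : Holds (Function.update P i b) v a ↔ Holds P v a := by
  cases v with
  | none => simp [holds_none]
  | some j =>
    rw [holds_some, holds_some, Function.update_of_ne (fun h => hv (congrArg some h))]

theorem isMostPreferredHolder_update {n : ℕ} {O : Type} {r : Node n → Node n → Prop}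
    (P : Placement n O) (i : Fin n) (b a : O) (v : Node n) :
    IsMostPreferredHolder r {v | v ≠ some i} (Function.update P i b) a v ↔
      IsMostPreferredHolder r {v | v ≠ some i} P a v := by
  constructor
  · rintro ⟨h1, h2, h3⟩
    exact ⟨h1, (holds_update P i b h1 a).1 h2,
      fun w hw hPw => h3 w hw ((holds_update P i b hw a).2 hPw)⟩
  · rintro ⟨h1, h2, h3⟩
    exact ⟨h1, (holds_update P i b h1 a).2 h2,
      fun w hw hPw => h3 w hw ((holds_update P i b hw a).1 hPw)⟩

/-- The server holds every object, so the finite set of holders is nonempty and a total preorder has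
a best element on it. -/
theorem exists_isMostPreferredHolder {n : ℕ} {O : Type} {r : Node n → Node n → Prop}
    (htot : ∀ v w, r v w ∨ r w v) (htr : ∀ u v w, r u v → r v w → r u w)
    (P : Placement n O) (a : O) : ∃ v, IsMostPreferredHolder r Set.univ P a v := by
  classical
  suffices h : ∀ s : Finset (Node n), s.Nonempty → ∃ v ∈ s, ∀ w ∈ s, r v w by
    obtain ⟨v, hv, h⟩ := h {v | Holds P v a} ⟨none, by simp [holds_none]⟩
    exact ⟨v, trivial, by simpa using hv, fun w _ hw => h w (by simpa using hw)⟩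
  intro s hs
  induction hs using Finset.Nonempty.cons_induction with
  | singleton v => exact ⟨v, by simp, by simpa using (htot v v).elim id id⟩
  | cons u s hu hs ih =>
    obtain ⟨v, hv, h⟩ := ih
    rcases htot u v with huv | hvu
    · refine ⟨u, by simp, fun w hw => ?_⟩
      rcases Finset.mem_cons.1 hw with rfl | hw
      · exact (htot w w).elim id id
      · exact htr _ _ _ huv (h w hw)
    · refine ⟨v, by simp [hv], fun w hw => ?_⟩
      rcases Finset.mem_cons.1 hw with rfl | hw
      · exact hvu
      · exact h w hw

namespace CSRGame

variable {n : ℕ} {O : Type}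

theorem nodePref_refl (G : CSRGame n O) (i : Fin n) (v : Node n) : G.nodePref i v v :=
  (G.nodePref_total i v v).elim id id

theorem exists_holder (G : CSRGame n O) (i : Fin n) (P : Placement n O) (a : O) :
    ∃ v, IsMostPreferredHolder (G.nodePref i) Set.univ P a v :=
  exists_isMostPreferredHolder (G.nodePref_total i) (G.nodePref_trans i) P a

/-- Termwise comparison of access sequences, as in the definition of binary preferences. -/
def TermwiseLE (G : CSRGame n O) (i : Fin n) (S : Finset O) (P Q : Placement n O) : Prop :=
  ∀ τ τ', G.IsAccessSequence i S P τ → G.IsAccessSequence i S Q τ' → ∀ k, G.nodePref i (τ k) (τ' k)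

theorem termwiseLE_empty (G : CSRGame n O) (i : Fin n) (P Q : Placement n O) :
    G.TermwiseLE i ∅ P Q :=
  fun _ _ _ _ k => k.elim0

theorem termwiseLE_singleton (G : CSRGame n O) (i : Fin n) (a : O) {P Q : Placement n O}
    {p q : Node n} (hp : IsMostPreferredHolder (G.nodePref i) Set.univ P a p)
    (hq : IsMostPreferredHolder (G.nodePref i) Set.univ Q a q) :
    G.TermwiseLE i {a} P Q ↔ G.nodePref i p q := by
  constructor
  · intro h
    have key : ∀ (R : Placement n O) v, IsMostPreferredHolder (G.nodePref i) Set.univ R a v →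
        G.IsAccessSequence i {a} R fun _ => v := by
      intro R v hv
      refine ⟨⟨(Finset.equivFin _).symm, fun k => ?_⟩, fun _ _ _ => G.nodePref_refl i v⟩
      rwa [Finset.mem_singleton.1 ((Finset.equivFin {a}).symm k).2]
    exact h _ _ (key P p hp) (key Q q hq) ⟨0, by simp⟩
  · rintro h τ τ' ⟨⟨e, he⟩, -⟩ ⟨⟨e', he'⟩, -⟩ k
    have h1 := he k
    have h2 := he' k
    rw [Finset.mem_singleton.1 (e k).2] at h1
    rw [Finset.mem_singleton.1 (e' k).2] at h2
    exact G.nodePref_trans _ _ _ _ (h1.2.2 p trivial hp.2.1)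
      (G.nodePref_trans _ _ _ _ h (hq.2.2 _ trivial h2.2.1))

/-- Makes the indices `0` and `1` of the two-term access sequences available. -/
instance : NeZero (Finset.univ : Finset Bool).card := ⟨by decide⟩

/-- A player holds one of the two objects itself, so only the access to the other object carries
information; it can be read off from entry `1`. -/
theorem isAccessSequence_univ (G : CSRGame n Bool) {i : Fin n} {P : Placement n Bool} {p : Node n}
    (hp : IsMostPreferredHolder (G.nodePref i) Set.univ P (!P i) p)
    {τ : Fin (Finset.univ : Finset Bool).card → Node n}
    (h : G.IsAccessSequence i Finset.univ P τ) :
    (∀ w, G.nodePref i (τ 0) w) ∧ G.nodePref i (τ 1) p ∧ G.nodePref i p (τ 1) := by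
  obtain ⟨⟨e, he⟩, hmono⟩ := h
  have htop : ∀ k, (e k).1 = P i → ∀ w, G.nodePref i (τ k) w := by
    intro k hk w
    have := (he k).2.2 (some i) trivial (by rw [holds_some, hk])
    exact G.nodePref_trans _ _ _ _ this (G.nodePref_self i w)
  have hother : ∀ k, (e k).1 = !P i → G.nodePref i (τ k) p ∧ G.nodePref i p (τ k) := by
    intro k hk
    have h1 := he k
    rw [hk] at h1
    exact ⟨h1.2.2 _ trivial hp.2.1, hp.2.2 _ trivial h1.2.1⟩
  have h01 : G.nodePref i (τ 0) (τ 1) := hmono 0 1 (by decide)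
  have hne : (e 0).1 ≠ (e 1).1 := fun h => by
    have := e.injective (Subtype.ext h)
    revert this
    decide
  by_cases h0 : (e 0).1 = P i
  · have h1 : (e 1).1 = !P i := Bool.eq_not_of_ne fun h => hne (h0.trans h.symm)
    exact ⟨htop 0 h0, hother 1 h1⟩
  -- The player's own object may come second only in a tie: then both entries are best possible
  -- nodes, and `p` is equivalent to them.
  · have h0' : (e 0).1 = !P i := Bool.eq_not_of_ne h0
    have h1 : (e 1).1 = P i := by
      rw [h0'] at hne
      generalize (e 1).1 = x at hne
      generalize P i = y at hne
      revert x y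
      decide
    have ht : ∀ w, G.nodePref i (τ 0) w := fun w =>
      G.nodePref_trans _ _ _ _ h01 (htop 1 h1 w)
    exact ⟨ht, htop 1 h1 p, G.nodePref_trans _ _ _ _ (hother 0 h0').2 (ht _)⟩

theorem exists_isAccessSequence_univ (G : CSRGame n Bool) {i : Fin n} {P : Placement n Bool}
    {p : Node n} (hp : IsMostPreferredHolder (G.nodePref i) Set.univ P (!P i) p) :
    ∃ τ, G.IsAccessSequence i Finset.univ P τ := by
  let e : Fin (Finset.univ : Finset Bool).card ≃ (Finset.univ : Finset Bool) :=
    { toFun := fun k => ⟨if k = 0 then P i else !P i, Finset.mem_univ _⟩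
      invFun := fun b => if b.1 = P i then 0 else 1
      left_inv := by
        intro k
        generalize P i = x
        revert k x
        decide
      right_inv := by
        intro k
        generalize P i = x
        revert k x
        decide }
  refine ⟨fun k => if k = 0 then some i else p, ⟨e, fun k => ?_⟩, fun k l hkl => ?_⟩
  · change IsMostPreferredHolder _ _ P (if k = 0 then P i else !P i) (if k = 0 then some i else p)
    by_cases hk : k = 0
    · rw [if_pos hk, if_pos hk]
      exact ⟨trivial, holds_some.2 rfl, fun w _ _ => G.nodePref_self i w⟩
    · rwa [if_neg hk, if_neg hk]
  · dsimp only
    by_cases hk : k = 0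
    · rw [if_pos hk]
      exact G.nodePref_self i _
    · have hl : l ≠ 0 := by
        revert k l
        decide
      rw [if_neg hk, if_neg hl]
      exact G.nodePref_refl i p

theorem termwiseLE_univ (G : CSRGame n Bool) {i : Fin n} {P Q : Placement n Bool} {p q : Node n}
    (hp : IsMostPreferredHolder (G.nodePref i) Set.univ P (!P i) p)
    (hq : IsMostPreferredHolder (G.nodePref i) Set.univ Q (!Q i) q) :
    G.TermwiseLE i Finset.univ P Q ↔ G.nodePref i p q := by
  constructor
  · intro h
    obtain ⟨τ, hτ⟩ := G.exists_isAccessSequence_univ hp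
    obtain ⟨τ', hτ'⟩ := G.exists_isAccessSequence_univ hq
    exact G.nodePref_trans _ _ _ _ (G.isAccessSequence_univ hp hτ).2.2
      (G.nodePref_trans _ _ _ _ (h τ τ' hτ hτ' 1) (G.isAccessSequence_univ hq hτ').2.1)
  · intro h τ τ' hτ hτ' k
    have h1 := G.isAccessSequence_univ hp hτ
    have h2 := G.isAccessSequence_univ hq hτ'
    have hk : k = 0 ∨ k = 1 := by
      revert k
      decide
    rcases hk with rfl | rfl
    · exact h1.1 _
    · exact G.nodePref_trans _ _ _ _ h1.2.1 (G.nodePref_trans _ _ _ _ h h2.2.2)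

theorem utilPref_refl (G : CSRGame n O) (i : Fin n) (P : Placement n O) : G.utilPref i P P :=
  (G.utilPref_total i P P).elim id id

variable {G : CSRGame n Bool} {S : Fin n → Finset Bool}

theorem HasBinaryPreferences.utilPref_update (h : G.HasBinaryPreferences S) (i : Fin n)
    (P : Placement n Bool) (a : Bool) : G.utilPref i P (Function.update P i a) ↔
      G.TermwiseLE i (S i) P (Function.update P i a) :=
  h i P _ fun j hj => by rw [Function.update_of_ne hj]

/-- Switching objects exchanges the roles of the two: the player is stable iff its best access to
`!P i` elsewhere is at least as good as its best access to `P i` elsewhere. Every other node holds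
one of the two objects, so this says that a holder of `!P i` is best among all other nodes. -/
theorem HasBinaryPreferences.isStableAt_univ (h : G.HasBinaryPreferences S) {i : Fin n}
    (hi : S i = Finset.univ) (P : Placement n Bool) : G.IsStableAt P i ↔
      ∃ v, v ≠ some i ∧ Holds P v (!P i) ∧ ∀ w, w ≠ some i → G.nodePref i v w := by
  obtain ⟨p, hp⟩ := G.exists_holder i P (!P i)
  set Q := Function.update P i (!P i) with hQ
  have hQi : (!Q i) = P i := by simp [hQ]
  obtain ⟨q, hq⟩ := G.exists_holder i Q (!Q i)
  have hpi : p ≠ some i := by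
    rintro rfl
    have := hp.2.1
    rw [holds_some] at this
    simp at this
  have hqi : q ≠ some i := by
    rintro rfl
    have := hq.2.1
    rw [holds_some] at this
    simp at this
  have key : G.IsStableAt P i ↔ G.nodePref i p q := by
    rw [← G.termwiseLE_univ hp hq, ← hi, hQ, ← h.utilPref_update]
    refine ⟨fun h => h _, fun h a => ?_⟩
    by_cases ha : a = P i
    · rw [ha, Function.update_eq_self]
      exact G.utilPref_refl i P
    · rwa [Bool.eq_not_of_ne ha]
  rw [key]
  constructor
  · intro hpq
    refine ⟨p, hpi, hp.2.1, fun w hw => ?_⟩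
    by_cases hw' : Holds P w (!P i)
    · exact hp.2.2 w trivial hw'
    · refine G.nodePref_trans _ _ _ _ hpq (hq.2.2 w trivial ?_)
      rw [hQi, hQ, holds_update P i _ hw]
      cases w with
      | none => exact holds_none _ _
      | some j =>
        rw [holds_some] at hw' ⊢
        simpa using hw'
  · rintro ⟨v, -, hv, hmax⟩
    exact G.nodePref_trans _ _ _ _ (hp.2.2 v trivial hv) (hmax q hqi)

theorem HasBinaryPreferences.isStableAt_of_singleton (h : G.HasBinaryPreferences S) {i : Fin n}
    {P : Placement n Bool} (hi : S i = {P i}) : G.IsStableAt P i := by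
  intro a
  obtain ⟨p, hp⟩ := G.exists_holder i P (P i)
  obtain ⟨q, hq⟩ := G.exists_holder i (Function.update P i a) (P i)
  rw [h.utilPref_update, hi, G.termwiseLE_singleton i _ hp hq]
  exact G.nodePref_trans _ _ _ _ (hp.2.2 (some i) trivial (holds_some.2 rfl)) (G.nodePref_self i q)

theorem HasBinaryPreferences.isStableAt_of_empty (h : G.HasBinaryPreferences S) {i : Fin n}
    {P : Placement n Bool} (hi : S i = ∅) : G.IsStableAt P i := by
  intro a
  rw [h.utilPref_update, hi]
  exact G.termwiseLE_empty i _ _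

/-- Equilibria exist if and only if every player reaches a free player or an even cycle. -/
theorem HasBinaryPreferences.exists_isEquilibrium_iff (h : G.HasBinaryPreferences S) :
    (∃ P, G.IsEquilibrium P) ↔
      ∀ i, (∃ w ∈ freePlayers G.nodePref S,
          Relation.ReflTransGen (nearestDigraph G.nodePref).Adj i w) ∨
        ReachesEvenCycle (nearestDigraph G.nodePref) i := by
  classical
  constructor
  · rintro ⟨P, hP⟩
    refine reaches_of_coloring _ _ P fun i hi => ?_
    simp only [freePlayers, Set.mem_ofPred_eq, not_or, not_not] at hi
    obtain ⟨v, hvi, hv, hmax⟩ := (h.isStableAt_univ hi.1 P).1 (hP i)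
    cases v with
    | none => exact (hi.2 hmax).elim
    | some j =>
      refine ⟨j, ⟨fun hji => hvi (congrArg some hji), hmax⟩, ?_⟩
      rw [holds_some.1 hv]
      simp
  · intro hr
    -- A player interested in a single object is assigned that object; for the other free players
    -- the prescribed colour is irrelevant.
    obtain ⟨P, hPb, hP⟩ := exists_coloring _ _ (fun i => decide (true ∈ S i)) hr
    refine ⟨P, fun i => ?_⟩
    by_cases hi : S i = Finset.univ
    · rw [h.isStableAt_univ hi]
      by_cases hf : i ∈ freePlayers G.nodePref S
      · exact ⟨none, by simp, holds_none _ _, hf.resolve_left (not_not.2 hi)⟩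
      · obtain ⟨j, ⟨hji, hmax⟩, hne⟩ := hP i hf
        exact ⟨some j, fun h => hji (Option.some_injective _ h),
          holds_some.2 (Bool.eq_not_of_ne hne), hmax⟩
    · have hb := hPb i (Or.inl hi)
      have hcases : ∀ T : Finset Bool, T = ∅ ∨ T = {decide (true ∈ T)} ∨ T = Finset.univ := by
        decide
      rcases hcases (S i) with h0 | h1 | h2
      · exact h.isStableAt_of_empty h0
      · exact h.isStableAt_of_singleton (h1.trans (by rw [hb]))
      · exact (hi h2).elim

end CSRGame

/-! ### The game with given node preferences and interest sets -/

namespace CSRGame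

variable {n : ℕ}

open Classical in
/-- The number of nodes that `v` is at least as good as. -/
noncomputable def nodeRank (r : Node n → Node n → Prop) (v : Node n) : ℕ :=
  (Finset.univ.filter fun w => r v w).card

/-- If `w` strictly beats `v`, the nodes counted for `v` form a proper subset of those counted for
`w`, which include `w` itself. Ranks turn preferences into numbers that can be added up to
utilities. -/
theorem nodeRank_le_iff {r : Node n → Node n → Prop} (htot : ∀ v w, r v w ∨ r w v)
    (htr : ∀ u v w, r u v → r v w → r u w) (v w : Node n) :
    nodeRank r w ≤ nodeRank r v ↔ r v w := by
  classical
  constructor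
  · intro h
    by_contra hvw
    have hwv := (htot v w).resolve_left hvw
    refine absurd h (not_le.2 (Finset.card_lt_card ⟨fun u hu => ?_, fun hsub => hvw ?_⟩))
    · simp only [Finset.mem_filter, Finset.mem_univ, true_and] at hu ⊢
      exact htr _ _ _ hwv hu
    · have := hsub (x := w) (by simpa using (htot w w).elim id id)
      simpa using this
  · intro h
    refine Finset.card_le_card fun u hu => ?_
    simp only [Finset.mem_filter, Finset.mem_univ, true_and] at hu ⊢
    exact htr _ _ _ h hu

open Classical in
/-- The rank of the most preferred holder of an object. -/
noncomputable def holderRank (r : Node n → Node n → Prop) (P : Placement n Bool) (a : Bool) : ℕ :=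
  Finset.univ.sup fun v => if Holds P v a then nodeRank r v else 0

theorem holderRank_eq {r : Node n → Node n → Prop} (htot : ∀ v w, r v w ∨ r w v)
    (htr : ∀ u v w, r u v → r v w → r u w) {P : Placement n Bool} {a : Bool} {p : Node n}
    (hp : IsMostPreferredHolder r Set.univ P a p) : holderRank r P a = nodeRank r p := by
  classical
  refine le_antisymm (Finset.sup_le fun v _ => ?_) ?_
  · split_ifs with hv
    · exact (nodeRank_le_iff htot htr p v).2 (hp.2.2 v trivial hv)
    · exact Nat.zero_le _
  · refine le_trans ?_ (Finset.le_sup (Finset.mem_univ p))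
    rw [if_pos hp.2.1]

theorem holderRank_congr {r : Node n → Node n → Prop} (htot : ∀ v w, r v w ∨ r w v)
    (htr : ∀ u v w, r u v → r v w → r u w) {i : Fin n} (hself : ∀ v, r (some i) v)
    {P Q : Placement n Bool} {a : Bool} (hi : P i = Q i)
    (h : ∀ p q, IsMostPreferredHolder r {v | v ≠ some i} P a p →
      IsMostPreferredHolder r {v | v ≠ some i} Q a q → r p q ∧ r q p) :
    holderRank r P a = holderRank r Q a := by
  obtain ⟨p, hp⟩ := exists_isMostPreferredHolder htot htr P a
  obtain ⟨q, hq⟩ := exists_isMostPreferredHolder htot htr Q a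
  rw [holderRank_eq htot htr hp, holderRank_eq htot htr hq]
  suffices hpq : r p q ∧ r q p from
    le_antisymm ((nodeRank_le_iff htot htr _ _).2 hpq.2) ((nodeRank_le_iff htot htr _ _).2 hpq.1)
  by_cases ha : P i = a
  · have h1 := hp.2.2 (some i) trivial (holds_some.2 ha)
    have h2 := hq.2.2 (some i) trivial (holds_some.2 (hi ▸ ha))
    exact ⟨htr _ _ _ h1 (hself q), htr _ _ _ h2 (hself p)⟩
  · refine h p q ⟨?_, hp.2.1, fun w _ => hp.2.2 w trivial⟩ ⟨?_, hq.2.1, fun w _ => hq.2.2 w trivial⟩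
    · rintro rfl
      exact ha (holds_some.1 hp.2.1)
    · rintro rfl
      exact ha (hi.trans (holds_some.1 hq.2.1))

/-- The utility is the sum, over the objects of interest, of the ranks of their most preferred
holders. If both objects are of interest, one summand is always the rank of the player itself, so
comparing sums amounts to comparing the access to the other object. -/
theorem exists_game (r : Fin n → Node n → Node n → Prop) (htot : ∀ i v w, r i v w ∨ r i w v)
    (htr : ∀ i u v w, r i u v → r i v w → r i u w) (hself : ∀ i v, r i (some i) v)
    (S : Fin n → Finset Bool) :
    ∃ G : CSRGame n Bool, G.nodePref = r ∧ G.HasBinaryPreferences S := by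
  let U : Fin n → Placement n Bool → ℕ := fun i P => ∑ a ∈ S i, holderRank (r i) P a
  let G : CSRGame n Bool :=
    { nodePref := r
      nodePref_total := htot
      nodePref_trans := htr
      nodePref_self := hself
      utilPref := fun i P Q => U i Q ≤ U i P
      utilPref_total := fun i P Q => le_total _ _
      utilPref_trans := fun i P Q R h1 h2 => h2.trans h1
      monotonicity := by
        intro i P Q h
        refine Finset.sum_le_sum fun a _ => ?_
        obtain ⟨p, hp⟩ := exists_isMostPreferredHolder (htot i) (htr i) P a
        obtain ⟨q, hq⟩ := exists_isMostPreferredHolder (htot i) (htr i) Q a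
        rw [holderRank_eq (htot i) (htr i) hp, holderRank_eq (htot i) (htr i) hq,
          nodeRank_le_iff (htot i) (htr i)]
        obtain ⟨p', hp', hle⟩ := h a q hq.2.1
        exact htr _ _ _ _ (hp.2.2 p' trivial hp') hle
      consistency := by
        intro i P Q h hlt
        by_cases hPQ : P i = Q i
        · rw [hPQ, Function.update_eq_self]
        -- With two objects and `P i ≠ Q i`, the consistency hypothesis covers every object; hence
        -- replacing the other players' part of `P` by that of `Q` changes no rank.
        have hall : ∀ a, a = P i ∨ a = Q i := by
          intro a
          generalize P i = x at hPQ
          generalize Q i = y at hPQ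
          revert a x y
          decide
        have h1 : U i P = U i (Function.update Q i (P i)) := by
          refine Finset.sum_congr rfl fun a _ =>
            holderRank_congr (htot i) (htr i) (hself i) (by simp) fun p q hp hq => ?_
          rw [isMostPreferredHolder_update] at hq
          exact h a (hall a) p q hp hq
        have h2 : U i (Function.update P i (Q i)) = U i Q := by
          refine Finset.sum_congr rfl fun a _ =>
            holderRank_congr (htot i) (htr i) (hself i) (by simp) fun p q hp hq => ?_
          rw [isMostPreferredHolder_update] at hp
          exact h a (hall a) p q hp hq
        rw [h1, h2] at hlt
        exact (not_le.1 hlt).le }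
  refine ⟨G, rfl, fun i P Q _ => ?_⟩
  change U i Q ≤ U i P ↔ G.TermwiseLE i (S i) P Q
  have hcases : ∀ T : Finset Bool, T = ∅ ∨ (∃ a, T = {a}) ∨ T = Finset.univ := by
    decide
  rcases hcases (S i) with h0 | ⟨a, h1⟩ | h2
  · rw [h0]
    simp [U, h0, G.termwiseLE_empty]
  · obtain ⟨p, hp⟩ := G.exists_holder i P a
    obtain ⟨q, hq⟩ := G.exists_holder i Q a
    rw [h1, G.termwiseLE_singleton i a hp hq]
    simp only [U, h1, Finset.sum_singleton]
    rw [holderRank_eq (htot i) (htr i) hp, holderRank_eq (htot i) (htr i) hq]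
    exact nodeRank_le_iff (htot i) (htr i) _ _
  · obtain ⟨p, hp⟩ := G.exists_holder i P (!P i)
    obtain ⟨q, hq⟩ := G.exists_holder i Q (!Q i)
    have hU : ∀ (R : Placement n Bool) v,
        IsMostPreferredHolder (r i) Set.univ R (!R i) v →
        U i R = nodeRank (r i) (some i) + nodeRank (r i) v := by
      intro R v hv
      have ht : IsMostPreferredHolder (r i) Set.univ R (R i) (some i) :=
        ⟨trivial, holds_some.2 rfl, fun w _ _ => hself i w⟩
      rw [← holderRank_eq (htot i) (htr i) hv, ← holderRank_eq (htot i) (htr i) ht]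
      simp only [U, h2, Fintype.sum_bool]
      cases R i <;> simp [add_comm]
    rw [h2, G.termwiseLE_univ hp hq, hU P p hp, hU Q q hq, add_le_add_iff_left]
    exact nodeRank_le_iff (htot i) (htr i) _ _

end CSRGame

/-! ### Stability of strongly connected digraphs -/

/-- Consecutive vertices of an even cycle are thus distinct, so removing loops destroys no even
cycle. -/
theorem one_ne_zero_of_even {k : ℕ} (hk : 0 < k) (he : Even k) : (1 : ZMod k) ≠ 0 := by
  intro h
  have h1 : k ∣ 1 := by
    rw [← Nat.cast_one, ZMod.natCast_eq_zero_iff] at h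
    exact h
  rw [Nat.dvd_one] at h1
  subst h1
  revert he
  decide

theorem reflTransGen_of_eq_or {V : Type} {r s : V → V → Prop} (h : ∀ u v, r u v → u = v ∨ s u v)
    {u v : V} (huv : Relation.ReflTransGen r u v) : Relation.ReflTransGen s u v := by
  induction huv with
  | refl => exact .refl
  | tail _ hbc ih =>
    rcases h _ _ hbc with rfl | hs
    · exact ih
    · exact ih.tail hs

/-! ### Distances and the nearest-node digraph of a digraph -/

theorem digraphDist_self {V : Type} (G : Digraph V) (u : V) : digraphDist G u u = 0 :=
  le_antisymm (sInf_le ⟨0, fun _ => u, rfl, rfl, fun _ h => (Nat.not_lt_zero _ h).elim, rfl⟩)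
    (zero_le)

theorem one_le_digraphDist {V : Type} (G : Digraph V) {u v : V} (h : u ≠ v) :
    1 ≤ digraphDist G u v := by
  refine le_sInf ?_
  rintro _ ⟨k, w, h0, hk, -, rfl⟩
  rcases Nat.eq_zero_or_pos k with rfl | hpos
  · exact (h (h0.symm.trans hk)).elim
  · exact_mod_cast hpos

theorem digraphDist_le_one {V : Type} {G : Digraph V} {u v : V} (h : G.Adj u v) :
    digraphDist G u v ≤ 1 :=
  sInf_le ⟨1, fun j => if j = 0 then u else v, rfl, rfl, fun j hj => by
    obtain rfl : j = 0 := by omega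
    exact h, by simp⟩

theorem adj_of_digraphDist_le_one {V : Type} {G : Digraph V} {u v : V} (hne : u ≠ v)
    (h : digraphDist G u v ≤ 1) : G.Adj u v := by
  -- The infimum is attained: over an empty set of walks it would be infinite, against `h`.
  have hmem := csInf_mem (s := {d : ℕ∞ | ∃ (k : ℕ) (w : ℕ → V), w 0 = u ∧ w k = v ∧
    (∀ j, j < k → G.Adj (w j) (w (j + 1))) ∧ d = k}) (by
      rw [Set.nonempty_iff_ne_empty]
      intro he
      rw [digraphDist, he, sInf_empty] at h
      exact absurd h (by decide))
  obtain ⟨k, w, h0, hk, hw, hd⟩ := hmem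
  change digraphDist G u v = k at hd
  rw [hd] at h
  have hk1 : k ≤ 1 := by exact_mod_cast h
  rcases Nat.le_one_iff_eq_zero_or_eq_one.1 hk1 with rfl | rfl
  · exact (hne (h0.symm.trans hk)).elim
  · rw [← h0, ← hk]
    exact hw 0 one_pos

/-- Nearer nodes are preferred. -/
def distPref {n : ℕ} (D : Digraph (Fin n)) (i : Fin n) (v w : Node n) : Prop :=
  nodeDist D i v ≤ nodeDist D i w

/-- Loops at the start of the walk are skipped. -/
theorem exists_step_ne {V : Type} {r : V → V → Prop} {u v : V}
    (h : Relation.ReflTransGen r u v) (huv : u ≠ v) :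
    ∃ w, w ≠ u ∧ r u w ∧ Relation.ReflTransGen r w v := by
  induction h using Relation.ReflTransGen.head_induction_on with
  | refl => exact (huv rfl).elim
  | @head a c hac hcv ih =>
    by_cases hca : c = a
    · subst hca
      exact ih huv
    · exact ⟨c, hca, hac, hcv⟩

section

variable {n : ℕ} {D : Digraph (Fin n)}

/-- Strong connectivity gives every player an out-neighbour other than itself, so the distance to
the nearest other nodes is exactly one. -/
theorem nearestDigraph_distPref_adj (hn : 2 ≤ n) (hD : StronglyConnected D) (i j : Fin n) :
    (nearestDigraph (distPref D)).Adj i j ↔ j ≠ i ∧ D.Adj i j := by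
  have : Nontrivial (Fin n) := Fin.nontrivial_iff_two_le.2 hn
  obtain ⟨v, hv⟩ := exists_ne i
  obtain ⟨u, hu, hadj, -⟩ := exists_step_ne (hD i v) hv.symm
  constructor
  · rintro ⟨hji, hmin⟩
    refine ⟨hji, adj_of_digraphDist_le_one hji.symm ?_⟩
    exact (hmin (some u) fun h => hu (Option.some_injective _ h)).trans (digraphDist_le_one hadj)
  · rintro ⟨hji, hadj⟩
    refine ⟨hji, fun w hw => (digraphDist_le_one hadj).trans ?_⟩
    cases w with
    | none => exact le_top
    | some w => exact one_le_digraphDist D fun h => hw (congrArg some h.symm)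

theorem freePlayers_distPref (hn : 2 ≤ n) (hD : StronglyConnected D) :
    freePlayers (distPref D) (fun _ => Finset.univ) = ∅ := by
  have : Nontrivial (Fin n) := Fin.nontrivial_iff_two_le.2 hn
  refine Set.eq_empty_of_forall_notMem fun i hi => ?_
  obtain ⟨v, hv⟩ := exists_ne i
  obtain ⟨u, hu, hadj, -⟩ := exists_step_ne (hD i v) hv.symm
  have h := hi.resolve_left (not_not.2 rfl) (some u) fun h => hu (Option.some_injective _ h)
  have h1 : (⊤ : ℕ∞) ≤ 1 := le_trans h (digraphDist_le_one hadj)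
  exact absurd h1 (by decide)

/-- Only loops have been removed from `D`; they affect neither even cycles nor reachability, and in
`D` everything is reachable. -/
theorem reachesEvenCycle_nearestDigraph_iff (hn : 2 ≤ n) (hD : StronglyConnected D) (i : Fin n) :
    ReachesEvenCycle (nearestDigraph (distPref D)) i ↔ HasEvenCycle D := by
  constructor
  · rintro ⟨k, hk, he, c, hc, ha, -⟩
    exact ⟨k, hk, he, c, hc, fun j => ((nearestDigraph_distPref_adj hn hD _ _).1 (ha j)).2⟩
  · rintro ⟨k, hk, he, c, hc, ha⟩
    refine ⟨k, hk, he, c, hc, fun j => (nearestDigraph_distPref_adj hn hD _ _).2 ⟨?_, ha j⟩, ?_⟩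
    · intro h
      exact one_ne_zero_of_even hk he (by simpa using hc h)
    · refine reflTransGen_of_eq_or (fun u v huv => ?_) (hD i (c 0))
      by_cases h : u = v
      · exact Or.inl h
      · exact Or.inr ((nearestDigraph_distPref_adj hn hD _ _).2 ⟨Ne.symm h, huv⟩)

theorem stableDigraph_iff_hasEvenCycle (hn : 2 ≤ n) (hD : StronglyConnected D) :
    StableDigraph D ↔ HasEvenCycle D := by
  have key : ∀ G : CSRGame n Bool, G.nodePref = distPref D →
      G.HasBinaryPreferences (fun _ => Finset.univ) →
      ((∃ P, G.IsEquilibrium P) ↔ HasEvenCycle D) := by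
    intro G hG h
    rw [h.exists_isEquilibrium_iff, hG, freePlayers_distPref hn hD]
    simp only [Set.mem_empty_iff_false, false_and, exists_false, false_or,
      reachesEvenCycle_nearestDigraph_iff hn hD]
    exact ⟨fun h => h ⟨0, by omega⟩, fun h _ => h⟩
  constructor
  · rintro ⟨G, S, h, ⟨hpref, hS⟩, hP⟩
    have hG : G.nodePref = distPref D := by
      funext i v w
      exact propext (hpref i v w)
    obtain rfl : S = fun _ => Finset.univ := funext hS
    exact (key G hG h).1 hP
  · intro hc
    obtain ⟨G, hG, h⟩ := CSRGame.exists_game (distPref D) (fun i v w => le_total _ _)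
      (fun i u v w => le_trans) (fun i v => by
        change digraphDist D i i ≤ _
        rw [digraphDist_self]
        exact zero_le) fun _ => Finset.univ
    exact ⟨G, _, h, ⟨fun i v w => by rw [hG]; rfl, fun _ => rfl⟩, (key G hG h).2 hc⟩

end

/-! ### Polynomial-time functions between encoded types -/

/-- Types whose elements are encoded as trees. -/
class Enc (α : Type) where
  /-- The encoding. -/
  enc : α → Data

open Enc

instance : Enc Bool := ⟨Data.ofBool⟩
instance : Enc Unit := ⟨fun _ => .nil⟩
instance {α : Type} [Enc α] : Enc (List α) := ⟨fun l => Data.ofList (l.map enc)⟩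
instance {α β : Type} [Enc α] [Enc β] : Enc (α × β) := ⟨fun p => .cons (enc p.1) (enc p.2)⟩
-- Numbers are in unary, so they are bounded by the size of their code and can serve directly as
-- loop counters.
instance : Enc ℕ := ⟨fun n => enc (List.replicate n ())⟩

namespace Data

theorem size_pos (d : Data) : 1 ≤ d.size := by
  cases d <;> simp [size]

theorem size_head_le (d : Data) : d.head.size ≤ d.size := by
  cases d <;> simp only [head, size] <;> omega

theorem size_tail_le (d : Data) : d.tail.size ≤ d.size := by
  cases d <;> simp only [tail, size] <;> omega

theorem length_lt_size_ofList (l : List Data) : l.length < (ofList l).size := by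
  induction l with
  | nil => simp [ofList, size]
  | cons a l ih =>
    simp only [ofList, size, List.length_cons]
    omega

theorem size_ofList_drop_le (l : List Data) (k : ℕ) : (ofList (l.drop k)).size ≤ (ofList l).size := by
  induction l generalizing k with
  | nil => simp
  | cons a l ih =>
    cases k with
    | zero => simp
    | succ k =>
      have := ih k
      simp only [List.drop_succ_cons, ofList, size]
      omega

theorem size_ofList_le (l : List Data) (b : ℕ) (h : ∀ d ∈ l, d.size ≤ b) :
    (ofList l).size ≤ l.length * (b + 1) + 1 := by
  induction l with
  | nil => simp [ofList, size]
  | cons a l ih =>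
    have h1 := ih fun d hd => h d (List.mem_cons_of_mem _ hd)
    have h2 := h a List.mem_cons_self
    simp only [ofList, size, List.length_cons, add_mul, one_mul]
    omega

theorem ofList_injective : Function.Injective ofList := by
  intro l
  induction l with
  | nil =>
    intro l' h
    cases l' with
    | nil => rfl
    | cons b l' => cases h
  | cons a l ih =>
    intro l' h
    cases l' with
    | nil => cases h
    | cons b l' =>
      simp only [ofList, cons.injEq] at h
      rw [h.1, ih h.2]

theorem ofBool_injective : Function.Injective ofBool := by
  intro a b h
  cases a <;> cases b <;> first | rfl | cases h

end Data

theorem Polynomial.eval_mono_nat (q : Polynomial ℕ) {m n : ℕ} (h : m ≤ n) :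
    q.eval m ≤ q.eval n := by
  rw [Polynomial.eval_eq_sum_range, Polynomial.eval_eq_sum_range]
  gcongr

/-- The factor 3 is the size of the answer "true" of the oracle, which may be charged only 1. An
output bound in terms of the cost is what makes polynomial bounds compose. -/
theorem Prog.Run.size_le {A : Set Data} {p : Prog} {x y : Data} {t : ℕ} (h : Prog.Run A p x y t) :
    y.size ≤ 3 * t := by
  induction h with
  | nil x =>
    have := x.size_pos
    simp only [Data.size]
    omega
  | id x => omega
  | head x =>
    have := x.size_head_le
    omega
  | tail x =>
    have := x.size_tail_le
    omega
  | @cons f g x y z s t _ _ _ _ =>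
    have := x.size_pos
    simp only [Data.size]
    omega
  | ask_yes hx =>
    rename_i x
    have := x.size_pos
    simp only [Data.ofBool, Data.size]
    omega
  | ask_no hx =>
    rename_i x
    have := x.size_pos
    simp only [Data.ofBool, Data.size]
    omega
  | _ => omega

/-- `f` is computed by a program with oracle `A` in polynomial time. -/
def PolyTime (A : Set Data) {α β : Type} [Enc α] [Enc β] (f : α → β) : Prop :=
  ∃ (p : Prog) (q : Polynomial ℕ), ∀ a, ∃ t, Prog.Run A p (enc a) (enc (f a)) t ∧
    t ≤ q.eval (enc a).size

theorem Prog.exists_const (A : Set Data) (d : Data) :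
    ∃ (p : Prog) (c : ℕ), ∀ x, ∃ t, Prog.Run A p x d t ∧ t ≤ c * x.size := by
  induction d with
  | nil => exact ⟨.nil, 1, fun x => ⟨_, .nil x, by simp⟩⟩
  | cons a b iha ihb =>
    obtain ⟨p, c, hp⟩ := iha
    obtain ⟨p', c', hp'⟩ := ihb
    refine ⟨.cons p p', 1 + c + c', fun x => ?_⟩
    obtain ⟨t, h, ht⟩ := hp x
    obtain ⟨t', h', ht'⟩ := hp' x
    refine ⟨_, .cons h h', ?_⟩
    rw [add_mul, add_mul, one_mul]
    omega

/-! ### Closure properties of polynomial-time functions -/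

namespace PolyTime

variable {A : Set Data} {α β γ δ : Type} [Enc α] [Enc β] [Enc γ] [Enc δ]

/-- The size of the output is polynomially bounded. -/
theorem size_le {f : α → β} (hf : PolyTime A f) :
    ∃ q : Polynomial ℕ, ∀ a, (enc (f a)).size ≤ q.eval (enc a).size := by
  obtain ⟨p, q, h⟩ := hf
  refine ⟨3 * q, fun a => ?_⟩
  obtain ⟨t, hr, ht⟩ := h a
  have := hr.size_le
  rw [Polynomial.eval_mul, Polynomial.eval_ofNat]
  omega

/-- Operations such as forming `a :: l` from a pair merely reinterpret the same tree. -/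
theorem of_enc_eq {f : α → β} (h : ∀ a, enc (f a) = enc a) : PolyTime A f :=
  ⟨.id, Polynomial.X, fun a => ⟨_, by rw [h]; exact .id _, by simp⟩⟩

theorem of_enc_eq_tail {f : α → β} (h : ∀ a, enc (f a) = (enc a).tail) : PolyTime A f :=
  ⟨.tail, Polynomial.X, fun a => ⟨_, by rw [h]; exact .tail _, by simp⟩⟩

theorem congr {f g : α → β} (hf : PolyTime A f) (h : ∀ a, f a = g a) : PolyTime A g :=
  funext h ▸ hf

theorem const (b : β) : PolyTime A fun _ : α => b := by
  obtain ⟨p, c, h⟩ := Prog.exists_const A (enc b)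
  refine ⟨p, (c : Polynomial ℕ) * Polynomial.X, fun a => ?_⟩
  obtain ⟨t, hr, ht⟩ := h (enc a)
  exact ⟨t, hr, by simpa using ht⟩

theorem id : PolyTime A fun a : α => a :=
  of_enc_eq fun _ => rfl

theorem comp {g : β → γ} {f : α → β} (hg : PolyTime A g) (hf : PolyTime A f) :
    PolyTime A fun a => g (f a) := by
  obtain ⟨r, hr⟩ := hf.size_le
  obtain ⟨p, q, hp⟩ := hf
  obtain ⟨p', q', hp'⟩ := hg
  refine ⟨.seq p p', Polynomial.X + q + q'.comp r, fun a => ?_⟩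
  obtain ⟨t, h, ht⟩ := hp a
  obtain ⟨t', h', ht'⟩ := hp' (f a)
  refine ⟨_, .seq h h', ?_⟩
  have := q'.eval_mono_nat (hr a)
  simp only [Polynomial.eval_add, Polynomial.eval_X, Polynomial.eval_comp]
  omega

theorem pair {f : α → β} {g : α → γ} (hf : PolyTime A f) (hg : PolyTime A g) :
    PolyTime A fun a => (f a, g a) := by
  obtain ⟨p, q, hp⟩ := hf
  obtain ⟨p', q', hp'⟩ := hg
  refine ⟨.cons p p', Polynomial.X + q + q', fun a => ?_⟩
  obtain ⟨t, h, ht⟩ := hp a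
  obtain ⟨t', h', ht'⟩ := hp' a
  refine ⟨_, .cons h h', ?_⟩
  simp only [Polynomial.eval_add, Polynomial.eval_X]
  omega

theorem fst {f : α → β × γ} (hf : PolyTime A f) : PolyTime A fun a => (f a).1 :=
  comp (g := Prod.fst) ⟨.head, Polynomial.X, fun p => ⟨_, .head (enc p), by simp⟩⟩ hf

theorem snd {f : α → β × γ} (hf : PolyTime A f) : PolyTime A fun a => (f a).2 :=
  comp (g := Prod.snd) ⟨.tail, Polynomial.X, fun p => ⟨_, .tail (enc p), by simp⟩⟩ hf

theorem ite {c : α → Bool} {f g : α → β} (hc : PolyTime A c) (hf : PolyTime A f)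
    (hg : PolyTime A g) : PolyTime A fun a => if c a then f a else g a := by
  obtain ⟨p, q, hp⟩ := hc
  obtain ⟨p', q', hp'⟩ := hf
  obtain ⟨p'', q'', hp''⟩ := hg
  refine ⟨.ite p p' p'', Polynomial.X + q + q' + q'', fun a => ?_⟩
  obtain ⟨t, h, ht⟩ := hp a
  obtain ⟨t', h', ht'⟩ := hp' a
  obtain ⟨t'', h'', ht''⟩ := hp'' a
  simp only [Polynomial.eval_add, Polynomial.eval_X]
  cases hca : c a with
  | true =>
    rw [hca] at h
    exact ⟨_, .ite_true h (by simp [enc, Data.ofBool]) h', by omega⟩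
  | false =>
    rw [hca] at h
    exact ⟨_, .ite_false h h'', by omega⟩

theorem ask {f : α → β} (hf : PolyTime A f) [DecidablePred fun b : β => enc b ∈ A] :
    PolyTime A fun a => decide (enc (f a) ∈ A) := by
  refine comp (g := fun b : β => decide (enc b ∈ A)) ⟨.ask, Polynomial.X, fun b => ?_⟩ hf
  refine ⟨_, ?_, by rw [Polynomial.eval_X]⟩
  by_cases hb : enc b ∈ A
  · dsimp only
    rw [decide_eq_true hb]
    exact .ask_yes hb
  · dsimp only
    rw [decide_eq_false hb]
    exact .ask_no hb

theorem not {f : α → Bool} (hf : PolyTime A f) : PolyTime A fun a => !f a := by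
  refine (hf.ite (const false) (const true)).congr fun a => ?_
  cases f a <;> rfl

theorem and {f g : α → Bool} (hf : PolyTime A f) (hg : PolyTime A g) :
    PolyTime A fun a => f a && g a := by
  refine (hf.ite hg (const false)).congr fun a => ?_
  cases f a <;> rfl

theorem or {f g : α → Bool} (hf : PolyTime A f) (hg : PolyTime A g) :
    PolyTime A fun a => f a || g a := by
  refine (hf.ite (const true) hg).congr fun a => ?_
  cases f a <;> rfl

theorem list_cons {f : α → β} {g : α → List β} (hf : PolyTime A f) (hg : PolyTime A g) :
    PolyTime A fun a => f a :: g a :=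
  comp (g := fun p : β × List β => p.1 :: p.2) (of_enc_eq fun _ => rfl) (hf.pair hg)

theorem list_tail {f : α → List β} (hf : PolyTime A f) : PolyTime A fun a => (f a).tail :=
  comp (g := fun l : List β => l.tail) (of_enc_eq_tail fun l => by cases l <;> rfl) hf

theorem list_isEmpty {f : α → List β} (hf : PolyTime A f) : PolyTime A fun a => (f a).isEmpty := by
  refine comp (g := fun l : List β => l.isEmpty) ⟨.ite .id .nil (.cons .nil .nil),
    5 * Polynomial.X, fun l => ?_⟩ hf
  simp only [Polynomial.eval_mul, Polynomial.eval_ofNat, Polynomial.eval_X]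
  cases l with
  | nil => exact ⟨_, .ite_false (.id _) (.cons (.nil _) (.nil _)), by omega⟩
  | cons b l =>
    exact ⟨_, .ite_true (.id _) (by simp [enc, Data.ofList]) (.nil _), by omega⟩

theorem list_headD {f : α → List β} (hf : PolyTime A f) (d : β) :
    PolyTime A fun a => (f a).headD d := by
  obtain ⟨p, c, hp⟩ := Prog.exists_const A (enc d)
  refine comp (g := fun l : List β => l.headD d) ⟨.ite .id .head p,
    ((c + 3 : ℕ) : Polynomial ℕ) * Polynomial.X, fun l => ?_⟩ hf
  simp only [Polynomial.eval_mul, Polynomial.eval_natCast, Polynomial.eval_X]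
  obtain ⟨t, hr, ht⟩ := hp (enc l)
  cases l with
  | nil =>
    refine ⟨_, .ite_false (.id _) hr, ?_⟩
    rw [Nat.cast_id, add_mul]
    omega
  | cons b l =>
    refine ⟨_, .ite_true (.id _) (by simp [enc, Data.ofList]) (.head _), ?_⟩
    rw [Nat.cast_id, add_mul]
    omega

theorem replicate_unit {f : α → ℕ} (hf : PolyTime A f) :
    PolyTime A fun a => List.replicate (f a) () :=
  comp (g := fun n => List.replicate n ()) (of_enc_eq fun _ => rfl) hf

theorem length_unit {f : α → List Unit} (hf : PolyTime A f) : PolyTime A fun a => (f a).length :=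
  comp (g := fun l : List Unit => l.length) (of_enc_eq fun l => by
    have hl : List.replicate l.length () = l :=
      (List.eq_replicate_iff.2 ⟨rfl, fun _ _ => rfl⟩).symm
    change enc (List.replicate l.length ()) = enc l
    rw [hl]) hf

theorem succ {f : α → ℕ} (hf : PolyTime A f) : PolyTime A fun a => f a + 1 := by
  simpa using ((const ()).list_cons hf.replicate_unit).length_unit

theorem pred {f : α → ℕ} (hf : PolyTime A f) : PolyTime A fun a => f a - 1 := by
  simpa using hf.replicate_unit.list_tail.length_unit

theorem isZero {f : α → ℕ} (hf : PolyTime A f) : PolyTime A fun a => decide (f a = 0) := by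
  refine hf.replicate_unit.list_isEmpty.congr fun a => ?_
  cases f a <;> simp [List.replicate_succ]

/-! #### Bounded recursion -/

/-- The loop state consists of the rest of the list, acting as a counter that is tested by `head`,
and of the pair `(a, b)`; a round drops one list cell and replaces `b` by `step (a, b)`. Each round
costs at most the second factor of the bound, as `L + (enc a).size + M + 2` bounds the state; the
extra round is the final failing test. -/
theorem run_loop {step : α × β → β} {p : Prog} {q : Polynomial ℕ}
    (hp : ∀ a, ∃ t, Prog.Run A p (enc a) (enc (step a)) t ∧ t ≤ q.eval (enc a).size)
    (a : α) (l : List Data) (b : β) (L M : ℕ) (hl : (Data.ofList l).size ≤ L)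
    (hb : ∀ k ≤ l.length, (enc ((fun b => step (a, b))^[k] b)).size ≤ M) :
    ∃ t, Prog.Run A (.loop .head (.cons (.seq .head .tail) (.seq .tail (.cons .head p))))
        (.cons (Data.ofList l) (enc (a, b)))
        (.cons .nil (enc (a, (fun b => step (a, b))^[l.length] b))) t ∧
      t ≤ (l.length + 1) *
        (11 * (L + (enc a).size + M + 2) + q.eval (L + (enc a).size + M + 2)) := by
  set K := 11 * (L + (enc a).size + M + 2) + q.eval (L + (enc a).size + M + 2) with hK
  induction l generalizing b with
  | nil =>
    refine ⟨_, .loop_done (.head _), ?_⟩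
    have := hb 0 le_rfl
    simp only [Function.iterate_zero_apply] at this
    simp only [Data.ofList, Data.size, enc, List.length_nil] at *
    omega
  | cons d l ih =>
    obtain ⟨t, hr, ht⟩ := hp (a, b)
    obtain ⟨u, hr', hu⟩ := ih (step (a, b)) (by
      simp only [Data.ofList, Data.size] at hl
      omega) (fun k hk => by
        have := hb (k + 1) (by simpa using hk)
        rwa [Function.iterate_succ_apply] at this)
    refine ⟨_, .loop_step (.head _) (by simp [Data.head, Data.ofList])
      (.cons (.seq (.head _) (.tail _)) (.seq (.tail _) (.cons (.head _) hr))) hr', ?_⟩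
    have h0 := hb 0 (Nat.zero_le _)
    simp only [Function.iterate_zero_apply] at h0
    have hx : (enc (a, b)).size ≤ L + (enc a).size + M + 2 := by
      simp only [enc, Data.size] at *
      omega
    have hq := q.eval_mono_nat hx
    have hh := (Data.ofList (d :: l)).size_head_le
    simp only [List.length_cons]
    rw [add_mul (l.length + 1) 1 K, one_mul]
    simp only [Data.head, Data.tail, Data.ofList, Data.size, enc] at *
    omega

/-- Iteration of a polynomial-time function stays polynomial-time when the number of iterations is
given by the length of a list and the intermediate values are polynomially bounded. -/
theorem iterate_length {c : α → List γ} {init : α → β} {step : α × β → β} (hc : PolyTime A c)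
    (hi : PolyTime A init) (hs : PolyTime A step) (r : Polynomial ℕ)
    (hr : ∀ a, ∀ k ≤ (c a).length,
      (enc ((fun b => step (a, b))^[k] (init a))).size ≤ r.eval (enc a).size) :
    PolyTime A fun a => (fun b => step (a, b))^[(c a).length] (init a) := by
  obtain ⟨m, hm⟩ := hc.size_le
  obtain ⟨pc, qc, hpc⟩ := hc
  obtain ⟨p_i, qi, hpi⟩ := hi
  obtain ⟨ps, qs, hps⟩ := hs
  -- Bounds the loop state at all times: list, `a`, intermediate value and two joining nodes.
  let Z : Polynomial ℕ := m + Polynomial.X + r + 2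
  refine ⟨.seq (.cons pc (.cons .id p_i)) (.seq (.loop .head
    (.cons (.seq .head .tail) (.seq .tail (.cons .head ps)))) (.seq .tail .tail)),
    4 * Polynomial.X + qc + qi + 5 * Z + (m + 1) * (11 * Z + qs.comp Z), fun a => ?_⟩
  obtain ⟨tc, hrc, htc⟩ := hpc a
  obtain ⟨ti, hri, hti⟩ := hpi a
  have hl := Data.length_lt_size_ofList ((c a).map enc)
  obtain ⟨u, hru, hu⟩ := run_loop hps a ((c a).map enc) (init a) (m.eval (enc a).size)
    (r.eval (enc a).size) (hm a) (by simpa using hr a)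
  rw [List.length_map] at hru hu hl
  refine ⟨_, .seq (.cons hrc (.cons (.id _) hri)) (.seq hru (.seq (.tail _) (.tail _))), ?_⟩
  have hZ : Z.eval (enc a).size = m.eval (enc a).size + (enc a).size + r.eval (enc a).size + 2 := by
    simp only [Z, Polynomial.eval_add, Polynomial.eval_X, Polynomial.eval_ofNat]
  simp only [Polynomial.eval_add, Polynomial.eval_mul, Polynomial.eval_X, Polynomial.eval_comp,
    Polynomial.eval_ofNat, Polynomial.eval_one]
  rw [← hZ] at hu
  have hcm : (c a).length + 1 ≤ m.eval (enc a).size + 1 := by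
    have := hm a
    change (Data.ofList ((c a).map enc)).size ≤ _ at this
    omega
  have hu' := hu.trans (Nat.mul_le_mul_right _ hcm)
  have h0 := hr a 0 (Nat.zero_le _)
  have h1 := hr a _ le_rfl
  have h2 := hm a
  simp only [Function.iterate_zero_apply] at h0
  simp only [Data.tail, Data.size]
  simp only [enc, Data.size] at *
  omega

theorem iterate {n : α → ℕ} {init : α → β} {step : α × β → β} (hn : PolyTime A n)
    (hi : PolyTime A init) (hs : PolyTime A step) (r : Polynomial ℕ)
    (hr : ∀ a, ∀ k ≤ n a,
      (enc ((fun b => step (a, b))^[k] (init a))).size ≤ r.eval (enc a).size) :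
    PolyTime A fun a => (fun b => step (a, b))^[n a] (init a) := by
  simpa using iterate_length hn.replicate_unit hi hs r (by simpa using hr)

end PolyTime

/-! ### Sizes of codes -/

theorem size_enc_nat (n : ℕ) : (enc n).size = 2 * n + 1 := by
  induction n with
  | zero => rfl
  | succ n ih =>
    have h : enc (n + 1) = .cons .nil (enc n) := rfl
    rw [h, Data.size, ih, Data.size]
    ring

theorem size_enc_prod {α β : Type} [Enc α] [Enc β] (p : α × β) :
    (enc p).size = (enc p.1).size + (enc p.2).size + 1 := rfl

theorem size_enc_bool_le (b : Bool) : (enc b).size ≤ 3 := by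
  cases b <;> decide

theorem size_enc_drop_le {α : Type} [Enc α] (l : List α) (k : ℕ) :
    (enc (l.drop k)).size ≤ (enc l).size := by
  simp only [enc, List.map_drop]
  exact Data.size_ofList_drop_le _ _

theorem size_enc_list_le {α : Type} [Enc α] (l : List α) (b : ℕ)
    (h : ∀ a ∈ l, (enc a).size ≤ b) : (enc l).size ≤ l.length * (b + 1) + 1 := by
  have := Data.size_ofList_le (l.map enc) b (by simpa using h)
  rw [List.length_map] at this
  exact this

/-! ### Equality of numbers, list access and bounded quantifiers -/

namespace PolyTime

variable {A : Set Data} {α β γ : Type} [Enc α] [Enc β] [Enc γ]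

theorem nat_eq {f g : α → ℕ} (hf : PolyTime A f) (hg : PolyTime A g) :
    PolyTime A fun a => decide (f a = g a) := by
  -- Equality is tested by truncated subtraction in both directions, and subtraction is iterated
  -- predecessor.
  have hsub : ∀ {f g : α → ℕ}, PolyTime A f → PolyTime A g → PolyTime A fun a => f a - g a := by
    intro f g hf hg
    have key : ∀ a k, (fun b => b - 1)^[k] (f a) = f a - k := by
      intro a k
      induction k with
      | zero => rfl
      | succ k ih => rw [Function.iterate_succ_apply', ih, Nat.sub_sub]
    obtain ⟨r, hr⟩ := hf.size_le
    refine (iterate (step := fun p => p.2 - 1) hg hf (snd id).pred r fun a k _ => ?_).congr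
      fun a => key a _
    refine le_trans ?_ (hr a)
    dsimp only
    rw [key, size_enc_nat, size_enc_nat]
    omega
  refine ((hsub hf hg).isZero.and (hsub hg hf).isZero).congr fun a => ?_
  rw [← Bool.decide_and]
  exact decide_eq_decide.2 (by omega)

theorem length {f : α → List β} (hf : PolyTime A f) : PolyTime A fun a => (f a).length := by
  have key : ∀ k, (fun b => b + 1)^[k] 0 = k := by
    intro k
    induction k with
    | zero => rfl
    | succ k ih => rw [Function.iterate_succ_apply', ih]
  obtain ⟨r, hr⟩ := hf.size_le
  refine (iterate_length (step := fun p => p.2 + 1) hf (const 0) (snd id).succ (2 * r)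
    fun a k hk => ?_).congr fun a => key _
  dsimp only
  rw [key, size_enc_nat, Polynomial.eval_mul, Polynomial.eval_ofNat]
  have h1 := hr a
  have h2 := Data.length_lt_size_ofList ((f a).map enc)
  rw [List.length_map] at h2
  change (Data.ofList ((f a).map enc)).size ≤ _ at h1
  omega

theorem list_getD {f : α → List β} {i : α → ℕ} (hf : PolyTime A f) (hi : PolyTime A i) (d : β) :
    PolyTime A fun a => (f a).getD (i a) d := by
  have key : ∀ (l : List β) k, (fun b => b.tail)^[k] l = l.drop k := by
    intro l k
    induction k with
    | zero => rfl
    | succ k ih => rw [Function.iterate_succ_apply', ih, List.tail_drop]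
  obtain ⟨r, hr⟩ := hf.size_le
  refine ((iterate (step := fun p => p.2.tail) hi hf (snd id).list_tail r
    fun a k _ => ?_).list_headD d).congr fun a => ?_
  · dsimp only
    rw [key]
    exact (size_enc_drop_le _ _).trans (hr a)
  · dsimp only
    rw [key, List.headD_eq_head?_getD, List.head?_drop, List.getD_eq_getElem?_getD]

/-- The state is a counter with the accumulated value. The counter runs downwards, since `foldr`
treats the last index first. All partial folds have to be bounded by `r`, because iterating a
polynomial-time step can blow up the size. -/
theorem foldr_range {n : α → ℕ} {init : α → β} {g : (α × ℕ) × β → β} (hn : PolyTime A n)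
    (hi : PolyTime A init) (hg : PolyTime A g) (r : Polynomial ℕ)
    (hr : ∀ a k, (enc (((List.range (n a)).drop k).foldr (fun i b => g ((a, i), b))
      (init a))).size ≤ r.eval (enc a).size) :
    PolyTime A fun a => (List.range (n a)).foldr (fun i b => g ((a, i), b)) (init a) := by
  let step : α × (ℕ × β) → ℕ × β := fun p => (p.2.1 - 1, g ((p.1, p.2.1 - 1), p.2.2))
  have hstep : PolyTime A step :=
    (snd id).fst.pred.pair (hg.comp (((fst id).pair (snd id).fst.pred).pair (snd id).snd))
  have key : ∀ a, ∀ k ≤ n a, (fun b => step (a, b))^[k] (n a, init a) =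
      (n a - k, ((List.range (n a)).drop (n a - k)).foldr (fun i b => g ((a, i), b)) (init a)) := by
    intro a k hk
    induction k with
    | zero => simp [List.drop_eq_nil_of_le]
    | succ k ih =>
      rw [Function.iterate_succ_apply', ih (by omega)]
      have hlt : n a - (k + 1) < (List.range (n a)).length := by
        rw [List.length_range]
        omega
      rw [List.drop_eq_getElem_cons hlt, List.getElem_range, List.foldr_cons]
      have h1 : n a - (k + 1) + 1 = n a - k := by omega
      rw [h1, ← Nat.sub_sub]
  obtain ⟨m, hm⟩ := hn.size_le
  refine (snd (iterate (init := fun a => (n a, init a)) hn (hn.pair hi) hstep (m + r + 1)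
    fun a k hk => ?_)).congr fun a => ?_
  · rw [key a k hk]
    have h1 := hm a
    have h2 := hr a (n a - k)
    have h3 := size_enc_nat (n a - k)
    rw [size_enc_nat] at h1
    simp only [Polynomial.eval_add, Polynomial.eval_one]
    rw [size_enc_prod]
    dsimp only
    omega
  · rw [key a _ le_rfl]
    simp

theorem map_range {n : α → ℕ} {f : α × ℕ → β} (hn : PolyTime A n) (hf : PolyTime A f) :
    PolyTime A fun a => (List.range (n a)).map fun i => f (a, i) := by
  obtain ⟨m, hm⟩ := hn.size_le
  obtain ⟨r, hr⟩ := hf.size_le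
  -- At most `m` entries, each bounded by `r` evaluated at a bound for the size of `(a, i)`.
  refine (foldr_range (g := fun p => f p.1 :: p.2) hn (const []) ((hf.comp (fst id)).list_cons
    (snd id)) (m * (r.comp (Polynomial.X + m + 1) + 1) + 1) fun a k => ?_).congr fun a => by
      rw [List.map_eq_foldr]
  have hd : ((List.range (n a)).drop k).foldr (fun i b => f (a, i) :: b) [] =
      ((List.range (n a)).drop k).map fun i => f (a, i) := (List.map_eq_foldr ..).symm
  dsimp only
  rw [hd]
  have h1 := hm a
  rw [size_enc_nat] at h1
  refine (size_enc_list_le _ ((r.comp (Polynomial.X + m + 1)).eval (enc a).size) ?_).trans ?_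
  · intro b hb
    obtain ⟨i, hi, rfl⟩ := List.mem_map.1 hb
    refine (hr _).trans ?_
    rw [Polynomial.eval_comp]
    refine r.eval_mono_nat ?_
    have hlt := List.mem_range.1 (List.mem_of_mem_drop hi)
    have h3 := size_enc_nat i
    simp only [Polynomial.eval_add, Polynomial.eval_one, Polynomial.eval_X]
    rw [size_enc_prod]
    dsimp only
    omega
  · simp only [Polynomial.eval_add, Polynomial.eval_one, Polynomial.eval_mul]
    gcongr
    simp only [List.length_map, List.length_drop, List.length_range]
    omega

theorem all_range {n : α → ℕ} {f : α × ℕ → Bool} (hn : PolyTime A n) (hf : PolyTime A f) :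
    PolyTime A fun a => (List.range (n a)).all fun i => f (a, i) := by
  refine (foldr_range (g := fun p => f p.1 && p.2) hn (const true) ((hf.comp (fst id)).and
    (snd id)) 3 fun a k => ?_).congr fun a => ?_
  · rw [Polynomial.eval_ofNat]
    exact size_enc_bool_le _
  · induction List.range (n a) with
    | nil => rfl
    | cons i l ih => exact congrArg _ ih

theorem any_range {n : α → ℕ} {f : α × ℕ → Bool} (hn : PolyTime A n) (hf : PolyTime A f) :
    PolyTime A fun a => (List.range (n a)).any fun i => f (a, i) := by
  refine (foldr_range (g := fun p => f p.1 || p.2) hn (const false) ((hf.comp (fst id)).or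
    (snd id)) 3 fun a k => ?_).congr fun a => ?_
  · rw [Polynomial.eval_ofNat]
    exact size_enc_bool_le _
  · induction List.range (n a) with
    | nil => rfl
    | cons i l ih => exact congrArg _ ih

end PolyTime

theorem DecisionProblem.PolyTimeReducible.of_polyTime {P Q : DecisionProblem} {α : Type} [Enc α]
    {code : P.Instance → α} (hcode : ∀ I, P.encode I = enc (code I)) {f : α → Bool}
    (hf : PolyTime Q.language f) (h : ∀ I, f (code I) = true ↔ P.Yes I) :
    P.PolyTimeReducible Q := by
  obtain ⟨p, q, hp⟩ := hf
  refine ⟨p, q, fun I => ?_⟩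
  obtain ⟨t, hr, ht⟩ := hp (code I)
  rw [hcode]
  refine ⟨_, t, hr, ht, ?_⟩
  rw [← h]
  cases f (code I) <;> simp [enc, Data.ofBool]

/-! ### Reachability in polynomial time -/

/-- Entry `(i, j)` of a bit matrix. -/
def bit (M : List (List Bool)) (i j : ℕ) : Bool := (M.getD i []).getD j false

/-- Add to a set of vertices, given by its bits, all their in-neighbours. -/
def expand (M : List (List Bool)) (n : ℕ) (B : List Bool) : List Bool :=
  (List.range n).map fun i => B.getD i false || (List.range n).any fun j => bit M i j && B.getD j false

/-- The bits of the set of vertices from which `v` is reachable. -/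
def coreach (M : List (List Bool)) (n v : ℕ) : List Bool :=
  (expand M n)^[n] ((List.range n).map fun i => decide (i = v))

namespace PolyTime

variable {A : Set Data} {α : Type} [Enc α]

theorem bit {M : α → List (List Bool)} {i j : α → ℕ} (hM : PolyTime A M) (hi : PolyTime A i)
    (hj : PolyTime A j) : PolyTime A fun a => bit (M a) (i a) (j a) :=
  (hM.list_getD hi []).list_getD hj false

theorem expand {M : α → List (List Bool)} {n : α → ℕ} {B : α → List Bool} (hM : PolyTime A M)
    (hn : PolyTime A n) (hB : PolyTime A B) : PolyTime A fun a => expand (M a) (n a) (B a) := by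
  refine map_range (f := fun p : α × ℕ => (B p.1).getD p.2 false ||
    (List.range (n p.1)).any fun j => _root_.bit (M p.1) p.2 j && (B p.1).getD j false) hn
    (((hB.comp (fst id)).list_getD (snd id) _).or ?_)
  exact any_range (f := fun q : (α × ℕ) × ℕ => _root_.bit (M q.1.1) q.1.2 q.2 &&
    (B q.1.1).getD q.2 false) (hn.comp (fst id))
    (((hM.comp (fst id).fst).bit (fst id).snd (snd id)).and
      ((hB.comp (fst id).fst).list_getD (snd id) _))

theorem coreach {M : α → List (List Bool)} {n v : α → ℕ} (hM : PolyTime A M)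
    (hn : PolyTime A n) (hv : PolyTime A v) : PolyTime A fun a => coreach (M a) (n a) (v a) := by
  obtain ⟨m, hm⟩ := hn.size_le
  refine iterate (step := fun p : α × List Bool => _root_.expand (M p.1) (n p.1) p.2) hn
    (map_range (f := fun p : α × ℕ => decide (p.2 = v p.1)) hn
      ((snd id).nat_eq (hv.comp (fst id))))
    ((hM.comp (fst id)).expand (hn.comp (fst id)) (snd id)) (m * 4 + 1) fun a k _ => ?_
  have hlen : ((fun b => _root_.expand (M a) (n a) b)^[k]
      ((List.range (n a)).map fun i => decide (i = v a))).length = n a := by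
    cases k with
    | zero => simp
    | succ k =>
      rw [Function.iterate_succ_apply']
      simp [_root_.expand]
  refine (size_enc_list_le _ 3 fun b _ => size_enc_bool_le b).trans ?_
  rw [hlen]
  have h1 := hm a
  rw [size_enc_nat] at h1
  simp only [Polynomial.eval_add, Polynomial.eval_one, Polynomial.eval_mul, Polynomial.eval_ofNat]
  omega

end PolyTime

theorem getD_map_range {β : Type} {n i : ℕ} (h : i < n) (f : ℕ → β) (d : β) :
    ((List.range n).map f).getD i d = f i := by
  simp [h]

theorem bit_map_range {n m i j : ℕ} (hi : i < n) (hj : j < m) (f : ℕ → ℕ → Bool) :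
    bit ((List.range n).map fun i => (List.range m).map fun j => f i j) i j = f i j := by
  rw [bit, getD_map_range hi, getD_map_range hj]

/-- An increasing operator on the subsets of an `n`-element type is stationary after `n` steps. -/
theorem iterate_stationary {V : Type} [Fintype V] (T : Finset V → Finset V) (hT : ∀ X, X ⊆ T X)
    (X : Finset V) : T (T^[Fintype.card V] X) = T^[Fintype.card V] X := by
  -- As long as the sets are not stationary, each step adds at least one element.
  have key : ∀ k, T (T^[k] X) = T^[k] X ∨ k ≤ (T^[k] X).card := by
    intro k
    induction k with
    | zero => exact Or.inr (Nat.zero_le _)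
    | succ k ih =>
      rw [Function.iterate_succ_apply']
      by_cases h : T (T^[k] X) = T^[k] X
      · exact Or.inl (by rw [h, h])
      · refine Or.inr (lt_of_le_of_lt (ih.resolve_left h) (Finset.card_lt_card ?_))
        exact (hT _).ssubset_of_ne (Ne.symm h)
  rcases key (Fintype.card V) with h | h
  · exact h
  · have hu : T^[Fintype.card V] X = Finset.univ :=
      Finset.eq_univ_of_card _ (le_antisymm (Finset.card_le_univ _) h)
    rw [hu]
    exact (Finset.subset_univ _).antisymm (hT _)

/-- On the level of vertex sets, `expand` adds all in-neighbours. After `n` rounds the set is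
stationary, hence closed under in-neighbours, and so contains all vertices that reach `v`. -/
theorem coreach_iff {n : ℕ} (G : Digraph (Fin n)) {M : List (List Bool)}
    (hM : ∀ i j : Fin n, bit M i j = true ↔ G.Adj i j) (i v : Fin n) :
    (coreach M n v).getD i false = true ↔ Relation.ReflTransGen G.Adj i v := by
  classical
  let T : Finset (Fin n) → Finset (Fin n) := fun X => {i | i ∈ X ∨ ∃ j ∈ X, G.Adj i j}
  let S : List Bool → Finset (Fin n) := fun B => {i | B.getD i false = true}
  have hS : ∀ B, S (expand M n B) = T (S B) := by
    intro B
    ext i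
    simp only [S, T, Finset.mem_filter, Finset.mem_univ, true_and, expand]
    rw [getD_map_range i.2]
    simp only [Bool.or_eq_true, List.any_eq_true, List.mem_range, Bool.and_eq_true]
    refine or_congr Iff.rfl ⟨?_, ?_⟩
    · rintro ⟨j, hj, h1, h2⟩
      exact ⟨⟨j, hj⟩, h2, (hM i ⟨j, hj⟩).1 h1⟩
    · rintro ⟨j, h2, h1⟩
      exact ⟨j, j.2, (hM i j).2 h1, h2⟩
  have hit : ∀ k B, S ((expand M n)^[k] B) = T^[k] (S B) := by
    intro k B
    induction k with
    | zero => rfl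
    | succ k ih => rw [Function.iterate_succ_apply', Function.iterate_succ_apply', hS, ih]
  have h0 : S ((List.range n).map fun i => decide (i = (v : ℕ))) = {v} := by
    ext i
    simp only [S, Finset.mem_filter, Finset.mem_univ, true_and, Finset.mem_singleton]
    rw [getD_map_range i.2, decide_eq_true_iff, Fin.val_inj]
  have hmem : (coreach M n v).getD i false = true ↔ i ∈ T^[n] {v} := by
    rw [← h0, ← hit]
    simp [S, coreach]
  rw [hmem]
  clear hmem
  have hTsub : ∀ X, X ⊆ T X := fun X i hi => by simp [T, hi]
  constructor
  · have : ∀ k i, i ∈ T^[k] {v} → Relation.ReflTransGen G.Adj i v := by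
      intro k
      induction k with
      | zero =>
        intro i hi
        rw [Finset.mem_singleton.1 hi]
      | succ k ih =>
        intro i hi
        rw [Function.iterate_succ_apply'] at hi
        simp only [T, Finset.mem_filter, Finset.mem_univ, true_and] at hi
        rcases hi with hi | ⟨j, hj, hij⟩
        · exact ih i hi
        · exact .head hij (ih j hj)
    exact this n i
  · intro h
    induction h using Relation.ReflTransGen.head_induction_on with
    | refl =>
      have : ∀ k, v ∈ T^[k] {v} := by
        intro k
        induction k with
        | zero => simp
        | succ k ih =>
          rw [Function.iterate_succ_apply']
          exact hTsub _ ih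
      exact this n
    | head hij _ ih =>
      have hst := iterate_stationary T hTsub {v}
      rw [Fintype.card_fin] at hst
      rw [← hst]
      simp only [T, Finset.mem_filter, Finset.mem_univ, true_and]
      exact Or.inr ⟨_, ih, hij⟩

/-! ### Codes of digraphs and games -/

theorem enc_bool_injective : Function.Injective (enc : Bool → Data) :=
  Data.ofBool_injective

theorem enc_list_injective {α : Type} [Enc α] (h : Function.Injective (enc : α → Data)) :
    Function.Injective (enc : List α → Data) := fun _ _ hl =>
  List.map_injective_iff.2 h (Data.ofList_injective hl)

theorem enc_prod_injective {α β : Type} [Enc α] [Enc β] (hα : Function.Injective (enc : α → Data))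
    (hβ : Function.Injective (enc : β → Data)) : Function.Injective (enc : α × β → Data) := by
  intro p q h
  obtain ⟨h1, h2⟩ := Data.cons.inj h
  exact Prod.ext (hα h1) (hβ h2)

open Classical in
/-- The adjacency matrix of a digraph. -/
noncomputable def codeDigraph {n : ℕ} (G : Digraph (Fin n)) : List (List Bool) :=
  List.ofFn fun i => List.ofFn fun j => decide (G.Adj i j)

theorem encodeDigraph_eq {n : ℕ} (G : Digraph (Fin n)) : encodeDigraph G = enc (codeDigraph G) := by
  simp only [encodeDigraph, codeDigraph, enc, List.map_ofFn, Function.comp_def]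

theorem length_codeDigraph {n : ℕ} (G : Digraph (Fin n)) : (codeDigraph G).length = n :=
  List.length_ofFn

theorem getD_ofFn {β : Type} {n : ℕ} (f : Fin n → β) (i : Fin n) (d : β) :
    (List.ofFn f).getD i d = f i := by
  simp

theorem bit_codeDigraph {n : ℕ} (G : Digraph (Fin n)) (i j : Fin n) :
    bit (codeDigraph G) i j = true ↔ G.Adj i j := by
  rw [bit, codeDigraph, getD_ofFn, getD_ofFn]
  exact @decide_eq_true_iff _ (_)

theorem map_range_eq_ofFn {β : Type} {n : ℕ} {f : ℕ → β} {g : Fin n → β} (h : ∀ i : Fin n, f i = g i) :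
    (List.range n).map f = List.ofFn g := by
  refine List.ext_getElem (by simp) fun i h1 h2 => ?_
  rw [List.length_ofFn] at h2
  simpa using h ⟨i, h2⟩

theorem map_range_eq_codeDigraph {n : ℕ} {G : Digraph (Fin n)} {f : ℕ → ℕ → Bool}
    (h : ∀ i j : Fin n, f i j = true ↔ G.Adj i j) :
    ((List.range n).map fun i => (List.range n).map fun j => f i j) = codeDigraph G :=
  map_range_eq_ofFn fun i => map_range_eq_ofFn fun j => by
    rw [Bool.eq_iff_iff, h]
    exact (@decide_eq_true_iff _ (_)).symm

/-- The oracle knows only the code; the code determines the digraph, so its answer concerns `G`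
itself. -/
theorem enc_codeDigraph_mem_language {n : ℕ} (G : Digraph (Fin n)) :
    enc (codeDigraph G) ∈ EvenCycle.language ↔ HasEvenCycle G := by
  rw [← encodeDigraph_eq]
  constructor
  · rintro ⟨⟨m, H⟩, he, hy⟩
    change encodeDigraph H = _ at he
    change HasEvenCycle H at hy
    rw [encodeDigraph_eq, encodeDigraph_eq] at he
    have hc := enc_list_injective (enc_list_injective enc_bool_injective) he
    obtain rfl : m = n := by
      have := congrArg List.length hc
      rwa [length_codeDigraph, length_codeDigraph] at this
    obtain rfl : H = G := by
      ext i j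
      rw [← bit_codeDigraph, hc, bit_codeDigraph]
    exact hy
  · exact fun h => ⟨⟨n, G⟩, rfl, h⟩

/-- The position of a node in the rows and columns of a preference matrix. -/
def nodeIdx {n : ℕ} : Node n → ℕ
  | none => 0
  | some j => j + 1

theorem nodeIdx_lt {n : ℕ} (v : Node n) : nodeIdx v < n + 1 := by
  cases v with
  | none => exact Nat.succ_pos n
  | some j => exact Nat.succ_lt_succ j.2

theorem nodeIdx_eq_iff {n : ℕ} (v : Node n) (i : Fin n) : nodeIdx v = i + 1 ↔ v = some i := by
  cases v with
  | none => simp [nodeIdx]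
  | some j => simp [nodeIdx, Fin.val_inj]

theorem exists_nodeIdx {n k : ℕ} (h : k < n + 1) : ∃ v : Node n, nodeIdx v = k := by
  cases k with
  | zero => exact ⟨none, rfl⟩
  | succ k => exact ⟨some ⟨k, Nat.lt_of_succ_lt_succ h⟩, rfl⟩

theorem map_range_eq_map_nodes {β : Type} {n : ℕ} {f : ℕ → β} {g : Node n → β}
    (h : ∀ v, f (nodeIdx v) = g v) :
    (List.range (n + 1)).map f = (none :: List.ofFn some).map g := by
  rw [List.range_succ_eq_map, List.map_cons, List.map_cons, List.map_map, List.map_ofFn]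
  exact congrArg₂ _ (h none) (map_range_eq_ofFn fun i => h (some i))

theorem getD_map_nodes {β : Type} {n : ℕ} (g : Node n → β) (v : Node n) (d : β) :
    ((none :: List.ofFn some).map g).getD (nodeIdx v) d = g v := by
  cases v with
  | none => rfl
  | some j =>
    rw [List.map_cons, List.map_ofFn, nodeIdx, List.getD_cons_succ, getD_ofFn]
    rfl

open Classical in
/-- The interest sets and preference matrices of all players. -/
noncomputable def codeGame {n : ℕ} (r : Fin n → Node n → Node n → Prop) (S : Fin n → Finset Bool) :
    List ((Bool × Bool) × List (List Bool)) :=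
  List.ofFn fun i => ((decide (false ∈ S i), decide (true ∈ S i)),
    (none :: List.ofFn some).map fun j => (none :: List.ofFn some).map fun k => decide (r i j k))

theorem encode_eq (I : BinaryTwoObjectGame) :
    I.encode = enc (codeGame I.game.nodePref I.interest) := by
  simp only [BinaryTwoObjectGame.encode, codeGame, enc, List.map_ofFn, Function.comp_def,
    List.map_map]

theorem length_codeGame {n : ℕ} (r : Fin n → Node n → Node n → Prop) (S : Fin n → Finset Bool) :
    (codeGame r S).length = n :=
  List.length_ofFn

/-- The data of player `i`. -/
def playerCode (L : List ((Bool × Bool) × List (List Bool))) (i : ℕ) :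
    (Bool × Bool) × List (List Bool) :=
  L.getD i ((false, false), [])

section

variable {n : ℕ} (r : Fin n → Node n → Node n → Prop) (S : Fin n → Finset Bool)

theorem bit_playerCode (i : Fin n) (v w : Node n) :
    bit (playerCode (codeGame r S) i).2 (nodeIdx v) (nodeIdx w) = true ↔ r i v w := by
  rw [playerCode, codeGame, getD_ofFn, bit, getD_map_nodes, getD_map_nodes]
  exact @decide_eq_true_iff _ (_)

theorem false_mem_iff_playerCode (i : Fin n) :
    (playerCode (codeGame r S) i).1.1 = true ↔ false ∈ S i := by
  rw [playerCode, codeGame, getD_ofFn, decide_eq_true_iff]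

theorem true_mem_iff_playerCode (i : Fin n) :
    (playerCode (codeGame r S) i).1.2 = true ↔ true ∈ S i := by
  rw [playerCode, codeGame, getD_ofFn, decide_eq_true_iff]

variable {r S}

theorem map_range_eq_codeGame {s t : ℕ → Bool} {f : ℕ → ℕ → ℕ → Bool}
    (hs : ∀ i : Fin n, s i = true ↔ false ∈ S i) (ht : ∀ i : Fin n, t i = true ↔ true ∈ S i)
    (hf : ∀ (i : Fin n) v w, f i (nodeIdx v) (nodeIdx w) = true ↔ r i v w) :
    ((List.range n).map fun i => ((s i, t i),
      (List.range (n + 1)).map fun j => (List.range (n + 1)).map fun k => f i j k)) =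
      codeGame r S := by
  refine map_range_eq_ofFn fun i => Prod.ext (Prod.ext ?_ ?_) ?_
  · rw [Bool.eq_iff_iff, hs, decide_eq_true_iff]
  · rw [Bool.eq_iff_iff, ht, decide_eq_true_iff]
  · dsimp only
    refine map_range_eq_map_nodes fun v => ?_
    refine map_range_eq_map_nodes fun w => ?_
    rw [Bool.eq_iff_iff, hf]
    exact (@decide_eq_true_iff _ (_)).symm

/-- The code does not determine the utility preferences in full. It determines node preferences and
interest sets, and by `exists_isEquilibrium_iff` the existence of equilibria depends only on these.
-/
theorem enc_codeGame_mem_language {G : CSRGame n Bool} (h : G.HasBinaryPreferences S) :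
    enc (codeGame G.nodePref S) ∈ TwoBin.language ↔ ∃ P, G.IsEquilibrium P := by
  constructor
  · rintro ⟨⟨m, H, S', h'⟩, he, hy⟩
    change BinaryTwoObjectGame.encode _ = _ at he
    change ∃ P, H.IsEquilibrium P at hy
    rw [encode_eq] at he
    have hc := enc_list_injective (enc_prod_injective
      (enc_prod_injective enc_bool_injective enc_bool_injective)
      (enc_list_injective (enc_list_injective enc_bool_injective))) he
    dsimp only at hc
    obtain rfl : m = n := by
      have := congrArg List.length hc
      rwa [length_codeGame, length_codeGame] at this
    have hr : H.nodePref = G.nodePref := by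
      funext i v w
      rw [eq_iff_iff, ← bit_playerCode H.nodePref S', hc, bit_playerCode]
    have hS : S' = S := by
      funext i
      ext b
      cases b
      · rw [← false_mem_iff_playerCode H.nodePref S', hc, false_mem_iff_playerCode]
      · rw [← true_mem_iff_playerCode H.nodePref S', hc, true_mem_iff_playerCode]
    subst hS
    rwa [h.exists_isEquilibrium_iff, ← hr, ← h'.exists_isEquilibrium_iff]
  · exact fun hP => ⟨⟨n, G, S, h⟩, encode_eq _, hP⟩

end

/-! ### Deciding the existence of even cycles with an oracle for games -/

section

variable {n : ℕ}

/-- Player `i` likes the out-neighbours in `B` best, and does not distinguish the other nodes. -/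
def targetPref (G : Digraph (Fin n)) (B : Set (Fin n)) (i : Fin n) (v w : Node n) : Prop :=
  v = some i ∨ w ≠ some i ∧
    ((∃ j ∈ B, v = some j ∧ G.Adj i j) ∨ ¬ ∃ j ∈ B, w = some j ∧ G.Adj i j)

open Classical in
/-- The players in `B` are interested in both objects, the others in none. -/
noncomputable def targetInterest (B : Set (Fin n)) (i : Fin n) : Finset Bool :=
  if i ∈ B then Finset.univ else ∅

theorem exists_targetGame (G : Digraph (Fin n)) (B : Set (Fin n)) :
    ∃ H : CSRGame n Bool, H.nodePref = targetPref G B ∧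
      H.HasBinaryPreferences (targetInterest B) := by
  refine CSRGame.exists_game _ (fun i v w => ?_) (fun i u v w => ?_) (fun i v => Or.inl rfl) _
  · unfold targetPref
    tauto
  · rintro (hu | ⟨hv, huv⟩) hvw
    · exact Or.inl hu
    · obtain ⟨hw, hvw⟩ := hvw.resolve_left hv
      exact Or.inr ⟨hw, huv.elim Or.inl fun h => Or.inr (hvw.resolve_left h)⟩

theorem targetInterest_eq_univ_iff (B : Set (Fin n)) (i : Fin n) :
    targetInterest B i = Finset.univ ↔ i ∈ B := by
  unfold targetInterest
  split_ifs with h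
  · simp [h]
  · simp only [h, iff_false]
    decide

variable {G : Digraph (Fin n)} {B : Set (Fin n)}

/-- Without an out-neighbour in `B` other than itself, the player would be indifferent between all
other nodes and adjacent to every other player. -/
theorem nearestDigraph_targetPref_adj {i : Fin n} (hi : ∃ u ∈ B, u ≠ i ∧ G.Adj i u) (j : Fin n) :
    (nearestDigraph (targetPref G B)).Adj i j ↔ j ∈ B ∧ j ≠ i ∧ G.Adj i j := by
  obtain ⟨u, hu, hui, hadj⟩ := hi
  constructor
  · rintro ⟨hji, h⟩
    rcases h (some u) (fun h => hui (Option.some_injective _ h)) with h | ⟨-, h | h⟩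
    · exact (hji (Option.some_injective _ h)).elim
    · obtain ⟨k, hk, hjk, ha⟩ := h
      obtain rfl := Option.some_injective _ hjk
      exact ⟨hk, hji, ha⟩
    · exact (h ⟨u, hu, rfl, hadj⟩).elim
  · rintro ⟨hj, hji, ha⟩
    exact ⟨hji, fun w hw => Or.inr ⟨hw, Or.inl ⟨j, hj, rfl, ha⟩⟩⟩

/-- For a member of `B`, an out-neighbour in `B` beats the server. -/
theorem mem_freePlayers_targetPref_iff {i : Fin n}
    (hB : ∀ i ∈ B, ∃ u ∈ B, u ≠ i ∧ G.Adj i u) :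
    i ∈ freePlayers (targetPref G B) (targetInterest B) ↔ i ∉ B := by
  rw [freePlayers, Set.mem_ofPred_eq, Ne, targetInterest_eq_univ_iff]
  refine ⟨fun h hi => ?_, Or.inl⟩
  obtain ⟨u, hu, hui, hadj⟩ := hB i hi
  rcases h.resolve_left (not_not.2 hi) (some u) (fun h => hui (Option.some_injective _ h)) with
    h | ⟨-, ⟨k, -, h, -⟩ | h⟩
  · cases h
  · cases h
  · exact h ⟨u, hu, rfl, hadj⟩

/-- Arcs of the nearest-node digraph never leave `B`, so no free player is reachable from `v`, and
the even cycle reached instead consists of arcs of `G`. -/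
theorem hasEvenCycle_of_targetGame (hB : ∀ i ∈ B, ∃ u ∈ B, u ≠ i ∧ G.Adj i u) {v : Fin n}
    (hv : v ∈ B) (h : (∃ w ∈ freePlayers (targetPref G B) (targetInterest B),
        Relation.ReflTransGen (nearestDigraph (targetPref G B)).Adj v w) ∨
      ReachesEvenCycle (nearestDigraph (targetPref G B)) v) : HasEvenCycle G := by
  have hstay : ∀ w, Relation.ReflTransGen (nearestDigraph (targetPref G B)).Adj v w → w ∈ B := by
    intro w hw
    induction hw with
    | refl => exact hv
    | tail _ hbc ih => exact ((nearestDigraph_targetPref_adj (hB _ ih) _).1 hbc).1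
  rcases h with ⟨w, hw, hr⟩ | ⟨k, hk, he, c, hc, ha, hr⟩
  · exact ((mem_freePlayers_targetPref_iff hB).1 hw (hstay w hr)).elim
  · refine ⟨k, hk, he, c, hc, fun j => ?_⟩
    have hj := hstay _ (hr.trans (reflTransGen_cycle hk ha 0 j))
    exact ((nearestDigraph_targetPref_adj (hB _ hj) _).1 (ha j)).2.2

/-- A vertex other than `v` moves along a walk to `v`; only `v` itself needs the hypothesis. -/
theorem coreach_closed {v : Fin n}
    (hv : ∃ u, u ≠ v ∧ G.Adj v u ∧ Relation.ReflTransGen G.Adj u v) :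
    ∀ i ∈ {i | Relation.ReflTransGen G.Adj i v},
      ∃ u ∈ {i | Relation.ReflTransGen G.Adj i v}, u ≠ i ∧ G.Adj i u := by
  intro i hi
  by_cases h : i = v
  · subst h
    obtain ⟨u, hu, ha, hr⟩ := hv
    exact ⟨u, hr, hu, ha⟩
  · obtain ⟨u, hu, ha, hr⟩ := exists_step_ne hi h
    exact ⟨u, hr, hu, ha⟩

/-- The whole cycle lies in `B`. From a member of `B`, a walk to `c 0` stays in `B` and, loops
removed, uses nearest-node arcs only; players outside `B` are free. -/
theorem targetGame_of_cycle {k : ℕ} (hk : 0 < k) (he : Even k) {c : ZMod k → Fin n}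
    (hc : Function.Injective c) (ha : ∀ j, G.Adj (c j) (c (j + 1))) (i : Fin n) :
    (∃ w ∈ freePlayers (targetPref G {i | Relation.ReflTransGen G.Adj i (c 0)})
        (targetInterest {i | Relation.ReflTransGen G.Adj i (c 0)}),
      Relation.ReflTransGen (nearestDigraph
        (targetPref G {i | Relation.ReflTransGen G.Adj i (c 0)})).Adj i w) ∨
    ReachesEvenCycle
      (nearestDigraph (targetPref G {i | Relation.ReflTransGen G.Adj i (c 0)})) i := by
  set B := {i | Relation.ReflTransGen G.Adj i (c 0)}
  have hne : ∀ j, c (j + 1) ≠ c j := fun j h => one_ne_zero_of_even hk he (by simpa using hc h)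
  have hcB : ∀ j, c j ∈ B := fun j => reflTransGen_cycle hk ha j 0
  have hB : ∀ i ∈ B, ∃ u ∈ B, u ≠ i ∧ G.Adj i u :=
    coreach_closed ⟨c (0 + 1), hne 0, ha 0, hcB _⟩
  by_cases hi : i ∈ B
  · refine Or.inr ⟨k, hk, he, c, hc, fun j => ?_, ?_⟩
    · exact (nearestDigraph_targetPref_adj (hB _ (hcB j)) _).2 ⟨hcB _, hne j, ha j⟩
    · have hi' : Relation.ReflTransGen G.Adj i (c 0) := hi
      clear hi
      induction hi' using Relation.ReflTransGen.head_induction_on with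
      | refl => exact .refl
      | @head a b hab hbc ih =>
        by_cases h : b = a
        · rwa [h] at ih
        · exact .head ((nearestDigraph_targetPref_adj (hB a (.head hab hbc)) _).2 ⟨hbc, h, hab⟩) ih
  · exact Or.inl ⟨i, (mem_freePlayers_targetPref_iff hB).2 hi, .refl⟩

end

/-- Bit version of "`j` is an out-neighbour of `i` in `B`", for nodes `j`. -/
def targetBit (M : List (List Bool)) (B : List Bool) (i j : ℕ) : Bool :=
  -- Position 0 is the server and position `j` is player `j - 1`.
  !decide (j = 0) && (bit M i (j - 1) && B.getD (j - 1) false)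

/-- The code of the game that is asked about. -/
def targetQuery (M : List (List Bool)) (B : List Bool) : List ((Bool × Bool) × List (List Bool)) :=
  (List.range M.length).map fun i => ((B.getD i false, B.getD i false),
    (List.range (M.length + 1)).map fun j => (List.range (M.length + 1)).map fun k =>
      decide (j = i + 1) || (!decide (k = i + 1) && (targetBit M B i j || !targetBit M B i k)))

open Classical in
/-- Decides whether there is an even cycle, with an oracle for games. -/
noncomputable def evenCycleDecider (M : List (List Bool)) : Bool :=
  (List.range M.length).any fun v =>
    -- Without this test, `v` could be indifferent between all other nodes and therefore free, and
    -- an equilibrium would prove nothing.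
    ((List.range M.length).any fun u =>
      !decide (u = v) && (bit M v u && (coreach M M.length v).getD u false)) &&
    decide (enc (targetQuery M (coreach M M.length v)) ∈ TwoBin.language)

/-! ### Running time of the even-cycle decider -/

namespace PolyTime

variable {A : Set Data} {α : Type} [Enc α]

theorem targetBit {M : α → List (List Bool)} {B : α → List Bool} {i j : α → ℕ}
    (hM : PolyTime A M) (hB : PolyTime A B) (hi : PolyTime A i) (hj : PolyTime A j) :
    PolyTime A fun a => targetBit (M a) (B a) (i a) (j a) :=
  (hj.nat_eq (const 0)).not.and ((hM.bit hi hj.pred).and (hB.list_getD hj.pred _))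

theorem targetQuery {M : α → List (List Bool)} {B : α → List Bool} (hM : PolyTime A M)
    (hB : PolyTime A B) : PolyTime A fun a => targetQuery (M a) (B a) := by
  have hbit := (hB.comp (fst id)).list_getD (snd (α := α × ℕ) id) false
  refine map_range (n := fun a => (M a).length) (f := fun p : α × ℕ =>
    (((B p.1).getD p.2 false, (B p.1).getD p.2 false),
      (List.range ((M p.1).length + 1)).map fun j => (List.range ((M p.1).length + 1)).map fun k =>
        decide (j = p.2 + 1) || (!decide (k = p.2 + 1) &&
          (_root_.targetBit (M p.1) (B p.1) p.2 j || !_root_.targetBit (M p.1) (B p.1) p.2 k))))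
    hM.length ((hbit.pair hbit).pair ?_)
  refine map_range (f := fun q : (α × ℕ) × ℕ =>
    (List.range ((M q.1.1).length + 1)).map fun k =>
      decide (q.2 = q.1.2 + 1) || (!decide (k = q.1.2 + 1) &&
        (_root_.targetBit (M q.1.1) (B q.1.1) q.1.2 q.2 ||
          !_root_.targetBit (M q.1.1) (B q.1.1) q.1.2 k)))
    (hM.comp (fst id)).length.succ ?_
  have hM' := hM.comp (fst (fst (fst (α := ((α × ℕ) × ℕ) × ℕ) id)))
  have hB' := hB.comp (fst (fst (fst (α := ((α × ℕ) × ℕ) × ℕ) id)))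
  exact map_range (f := fun s : ((α × ℕ) × ℕ) × ℕ =>
      decide (s.1.2 = s.1.1.2 + 1) || (!decide (s.2 = s.1.1.2 + 1) &&
        (_root_.targetBit (M s.1.1.1) (B s.1.1.1) s.1.1.2 s.1.2 ||
          !_root_.targetBit (M s.1.1.1) (B s.1.1.1) s.1.1.2 s.2)))
    (hM.comp (fst (fst id))).length.succ
    (((fst id).snd.nat_eq (fst id).fst.snd.succ).or (((snd id).nat_eq (fst id).fst.snd.succ).not.and
      ((hM'.targetBit hB' (fst id).fst.snd (fst id).snd).or
        (hM'.targetBit hB' (fst id).fst.snd (snd id)).not)))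

theorem evenCycleDecider : PolyTime TwoBin.language evenCycleDecider := by
  classical
  have hco : PolyTime TwoBin.language fun p : List (List Bool) × ℕ =>
      _root_.coreach p.1 p.1.length p.2 := coreach (fst id) (fst id).length (snd id)
  refine any_range (f := fun p : List (List Bool) × ℕ => ((List.range p.1.length).any fun u =>
      !decide (u = p.2) && (_root_.bit p.1 p.2 u &&
        (_root_.coreach p.1 p.1.length p.2).getD u false)) &&
    decide (enc (_root_.targetQuery p.1 (_root_.coreach p.1 p.1.length p.2)) ∈ TwoBin.language))
    (length id) (and ?_ (ask (targetQuery (fst id) hco)))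
  exact any_range (f := fun q : (List (List Bool) × ℕ) × ℕ => !decide (q.2 = q.1.2) &&
      (_root_.bit q.1.1 q.1.2 q.2 && (_root_.coreach q.1.1 q.1.1.length q.1.2).getD q.2 false))
    (length (fst id)) (((snd id).nat_eq (fst id).snd).not.and
      ((bit (fst id).fst (fst id).snd (snd id)).and ((hco.comp (fst id)).list_getD (snd id) _)))

end PolyTime

/-! ### Correctness of the even-cycle decider -/

section

variable {n : ℕ}

theorem targetBit_iff (G : Digraph (Fin n)) (v i : Fin n) (w : Node n) :
    targetBit (codeDigraph G) (coreach (codeDigraph G) n v) i (nodeIdx w) = true ↔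
      ∃ j ∈ {i | Relation.ReflTransGen G.Adj i v}, w = some j ∧ G.Adj i j := by
  cases w with
  | none => simp [targetBit, nodeIdx]
  | some j =>
    rw [targetBit, nodeIdx, Nat.add_sub_cancel, Bool.and_eq_true, Bool.and_eq_true,
      bit_codeDigraph, coreach_iff G (bit_codeDigraph G)]
    simp [and_comm]

theorem targetQuery_eq (G : Digraph (Fin n)) (v : Fin n) :
    targetQuery (codeDigraph G) (coreach (codeDigraph G) n v) =
      codeGame (targetPref G {i | Relation.ReflTransGen G.Adj i v})
        (targetInterest {i | Relation.ReflTransGen G.Adj i v}) := by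
  have hmem : ∀ (b : Bool) (i : Fin n),
      (coreach (codeDigraph G) n v).getD i false = true ↔
        b ∈ targetInterest {i | Relation.ReflTransGen G.Adj i v} i := by
    intro b i
    rw [coreach_iff G (bit_codeDigraph G), targetInterest]
    split_ifs with h
    · simpa using h
    · simpa using h
  rw [targetQuery, length_codeDigraph]
  refine map_range_eq_codeGame (hmem false) (hmem true) fun i x y => ?_
  rw [Bool.or_eq_true, Bool.and_eq_true, Bool.or_eq_true, Bool.not_eq_true', Bool.not_eq_true',
    decide_eq_true_iff, decide_eq_false_iff_not, nodeIdx_eq_iff, nodeIdx_eq_iff,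
    ← Bool.not_eq_true, targetBit_iff, targetBit_iff]
  rfl

theorem evenCycleDecider_iff (G : Digraph (Fin n)) :
    evenCycleDecider (codeDigraph G) = true ↔ HasEvenCycle G := by
  rw [evenCycleDecider, length_codeDigraph]
  simp only [List.any_eq_true, List.mem_range, Bool.and_eq_true, decide_eq_true_iff,
    Bool.not_eq_true', decide_eq_false_iff_not]
  have hask : ∀ v : Fin n, enc (targetQuery (codeDigraph G) (coreach (codeDigraph G) n v)) ∈
      TwoBin.language ↔ ∀ i,
        (∃ w ∈ freePlayers (targetPref G {i | Relation.ReflTransGen G.Adj i v})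
            (targetInterest {i | Relation.ReflTransGen G.Adj i v}),
          Relation.ReflTransGen (nearestDigraph
            (targetPref G {i | Relation.ReflTransGen G.Adj i v})).Adj i w) ∨
        ReachesEvenCycle
          (nearestDigraph (targetPref G {i | Relation.ReflTransGen G.Adj i v})) i := by
    intro v
    obtain ⟨H, hH, hbin⟩ := exists_targetGame G {i | Relation.ReflTransGen G.Adj i v}
    rw [targetQuery_eq, ← hH, enc_codeGame_mem_language hbin, hbin.exists_isEquilibrium_iff]
  constructor
  · rintro ⟨v, hv, ⟨u, hu, huv, ha, hr⟩, hq⟩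
    lift v to Fin n using hv
    lift u to Fin n using hu
    rw [bit_codeDigraph] at ha
    rw [coreach_iff G (bit_codeDigraph G)] at hr
    exact hasEvenCycle_of_targetGame (coreach_closed ⟨u, fun h => huv (congrArg _ h), ha, hr⟩)
      (v := v) .refl ((hask v).1 hq v)
  · rintro ⟨k, hk, he, c, hc, ha⟩
    refine ⟨c 0, (c 0).2, ⟨c (0 + 1), (c (0 + 1)).2, ?_, ?_, ?_⟩, ?_⟩
    · exact fun h => one_ne_zero_of_even hk he (by simpa using hc (Fin.ext h))
    · rw [bit_codeDigraph]
      exact ha 0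
    · rw [coreach_iff G (bit_codeDigraph G)]
      exact reflTransGen_cycle hk ha _ _
    · exact (hask _).2 (targetGame_of_cycle hk he hc ha)

end

theorem evenCycle_reducible_twoBin : EvenCycle.PolyTimeReducible TwoBin :=
  .of_polyTime (code := fun I => codeDigraph I.2) (fun I => encodeDigraph_eq I.2)
    PolyTime.evenCycleDecider fun I => evenCycleDecider_iff I.2

/-! ### Deciding the existence of equilibria with an oracle for even cycles -/

/-- Bit version of "player `i` likes no other node better than the node `j`". -/
def topBit (L : List ((Bool × Bool) × List (List Bool))) (i j : ℕ) : Bool :=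
  (List.range (L.length + 1)).all fun k => decide (k = i + 1) || bit (playerCode L i).2 j k

/-- Bit version of the adjacency in the nearest-node digraph. -/
def nearestBit (L : List ((Bool × Bool) × List (List Bool))) (i j : ℕ) : Bool :=
  !decide (j = i) && topBit L i (j + 1)

/-- The transposed adjacency matrix of the nearest-node digraph. -/
def nearestTranspose (L : List ((Bool × Bool) × List (List Bool))) : List (List Bool) :=
  (List.range L.length).map fun j => (List.range L.length).map fun i => nearestBit L i j

/-- Bit version of the set of free players. -/
def freeBit (L : List ((Bool × Bool) × List (List Bool))) (i : ℕ) : Bool :=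
  !((playerCode L i).1.1 && (playerCode L i).1.2) || topBit L i 0

/-- The matrix of the digraph of all arcs of the nearest-node digraph that start in `R`. -/
def reachQuery (L : List ((Bool × Bool) × List (List Bool))) (R : List Bool) : List (List Bool) :=
  (List.range L.length).map fun i => (List.range L.length).map fun j =>
    nearestBit L i j && R.getD i false

open Classical in
/-- Decides whether there is an equilibrium, with an oracle for even cycles. -/
noncomputable def twoBinDecider (L : List ((Bool × Bool) × List (List Bool))) : Bool :=
  (List.range L.length).all fun v =>
    ((List.range L.length).any fun u =>
      (coreach (nearestTranspose L) L.length v).getD u false && freeBit L u) ||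
    decide (enc (reachQuery L (coreach (nearestTranspose L) L.length v)) ∈ EvenCycle.language)

/-! ### Running time of the equilibrium decider -/

namespace PolyTime

variable {A : Set Data} {α : Type} [Enc α] {L : α → List ((Bool × Bool) × List (List Bool))}

theorem playerCode (hL : PolyTime A L) {i : α → ℕ} (hi : PolyTime A i) :
    PolyTime A fun a => playerCode (L a) (i a) :=
  hL.list_getD hi _

theorem topBit (hL : PolyTime A L) {i j : α → ℕ} (hi : PolyTime A i) (hj : PolyTime A j) :
    PolyTime A fun a => topBit (L a) (i a) (j a) :=
  all_range (f := fun p : α × ℕ => decide (p.2 = i p.1 + 1) ||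
      _root_.bit (_root_.playerCode (L p.1) (i p.1)).2 (j p.1) p.2) hL.length.succ
    (((snd id).nat_eq (hi.comp (fst id)).succ).or
      (((hL.comp (fst id)).playerCode (hi.comp (fst id))).snd.bit (hj.comp (fst id)) (snd id)))

theorem nearestBit (hL : PolyTime A L) {i j : α → ℕ} (hi : PolyTime A i) (hj : PolyTime A j) :
    PolyTime A fun a => nearestBit (L a) (i a) (j a) :=
  (hj.nat_eq hi).not.and (hL.topBit hi hj.succ)

theorem nearestTranspose (hL : PolyTime A L) : PolyTime A fun a => nearestTranspose (L a) := by
  refine map_range (f := fun p : α × ℕ => (List.range (L p.1).length).map fun i =>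
    _root_.nearestBit (L p.1) i p.2) hL.length ?_
  exact map_range (f := fun q : (α × ℕ) × ℕ => _root_.nearestBit (L q.1.1) q.2 q.1.2)
    (hL.comp (fst id)).length ((hL.comp (fst id).fst).nearestBit (snd id) (fst id).snd)

theorem freeBit (hL : PolyTime A L) {i : α → ℕ} (hi : PolyTime A i) :
    PolyTime A fun a => freeBit (L a) (i a) :=
  ((hL.playerCode hi).fst.fst.and (hL.playerCode hi).fst.snd).not.or (hL.topBit hi (const 0))

theorem reachQuery (hL : PolyTime A L) {R : α → List Bool} (hR : PolyTime A R) :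
    PolyTime A fun a => reachQuery (L a) (R a) := by
  refine map_range (f := fun p : α × ℕ => (List.range (L p.1).length).map fun j =>
    _root_.nearestBit (L p.1) p.2 j && (R p.1).getD p.2 false) hL.length ?_
  exact map_range (f := fun q : (α × ℕ) × ℕ => _root_.nearestBit (L q.1.1) q.1.2 q.2 &&
      (R q.1.1).getD q.1.2 false) (hL.comp (fst id)).length
    (((hL.comp (fst id).fst).nearestBit (fst id).snd (snd id)).and
      ((hR.comp (fst id).fst).list_getD (fst id).snd _))

theorem twoBinDecider : PolyTime EvenCycle.language twoBinDecider := by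
  classical
  have hco : PolyTime EvenCycle.language
      fun p : List ((Bool × Bool) × List (List Bool)) × ℕ =>
        _root_.coreach (_root_.nearestTranspose p.1) p.1.length p.2 :=
    coreach (fst id).nearestTranspose (fst id).length (snd id)
  refine all_range (f := fun p : List ((Bool × Bool) × List (List Bool)) × ℕ =>
      ((List.range p.1.length).any fun u =>
        (_root_.coreach (_root_.nearestTranspose p.1) p.1.length p.2).getD u false &&
          _root_.freeBit p.1 u) ||
      decide (enc (_root_.reachQuery p.1
        (_root_.coreach (_root_.nearestTranspose p.1) p.1.length p.2)) ∈ EvenCycle.language))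
    (length id) (or ?_ (ask (reachQuery (fst id) hco)))
  exact any_range (f := fun q : (List ((Bool × Bool) × List (List Bool)) × ℕ) × ℕ =>
      (_root_.coreach (_root_.nearestTranspose q.1.1) q.1.1.length q.1.2).getD q.2 false &&
        _root_.freeBit q.1.1 q.2) (length (fst id))
    (((hco.comp (fst id)).list_getD (snd id) _).and ((fst id).fst.freeBit (snd id)))

end PolyTime

/-! ### Correctness of the equilibrium decider -/

section

variable {n : ℕ} (r : Fin n → Node n → Node n → Prop) (S : Fin n → Finset Bool)

theorem topBit_iff (i : Fin n) (v : Node n) :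
    topBit (codeGame r S) i (nodeIdx v) = true ↔ ∀ w, w ≠ some i → r i v w := by
  rw [topBit, length_codeGame]
  simp only [List.all_eq_true, List.mem_range, Bool.or_eq_true, decide_eq_true_iff]
  constructor
  · intro h w hw
    rw [← bit_playerCode r S]
    exact (h _ (nodeIdx_lt w)).resolve_left fun h => hw ((nodeIdx_eq_iff w i).1 h)
  · intro h k hk
    obtain ⟨w, rfl⟩ := exists_nodeIdx hk
    rw [nodeIdx_eq_iff, bit_playerCode]
    exact or_iff_not_imp_left.2 (h w)

theorem nearestBit_iff (i j : Fin n) :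
    nearestBit (codeGame r S) i j = true ↔ (nearestDigraph r).Adj i j := by
  rw [nearestBit, Bool.and_eq_true, Bool.not_eq_true', decide_eq_false_iff_not, Fin.val_inj]
  exact and_congr Iff.rfl (topBit_iff r S i (some j))

theorem freeBit_iff (i : Fin n) : freeBit (codeGame r S) i = true ↔ i ∈ freePlayers r S := by
  have huniv : ∀ T : Finset Bool, T ≠ Finset.univ ↔ ¬ (false ∈ T ∧ true ∈ T) := by
    decide
  rw [freeBit, Bool.or_eq_true, Bool.not_eq_true', ← Bool.not_eq_true, Bool.and_eq_true,
    false_mem_iff_playerCode, true_mem_iff_playerCode, freePlayers, Set.mem_ofPred_eq, huniv]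
  exact or_congr Iff.rfl (topBit_iff r S i none)

/-- Reversing all arcs turns the computation of backward reachability into one of forward
reachability. -/
theorem coreach_nearestTranspose_iff (i v : Fin n) :
    (coreach (nearestTranspose (codeGame r S)) n v).getD i false = true ↔
      Relation.ReflTransGen (nearestDigraph r).Adj v i := by
  rw [coreach_iff ⟨fun a b => (nearestDigraph r).Adj b a⟩, ← Relation.reflTransGen_swap]
  intro a b
  rw [nearestTranspose, length_codeGame, bit_map_range a.2 b.2, nearestBit_iff]

/-- Keeping only arcs that start in the reachable set removes the reachability condition, leaving a
question that the oracle can answer. -/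
theorem reachesEvenCycle_iff {V : Type} (G : Digraph V) (v : V) : ReachesEvenCycle G v ↔
    HasEvenCycle (⟨fun i j => G.Adj i j ∧ Relation.ReflTransGen G.Adj v i⟩ : Digraph V) := by
  constructor
  · rintro ⟨k, hk, he, c, hc, ha, hr⟩
    exact ⟨k, hk, he, c, hc, fun j => ⟨ha j, hr.trans (reflTransGen_cycle hk ha 0 j)⟩⟩
  · rintro ⟨k, hk, he, c, hc, ha⟩
    exact ⟨k, hk, he, c, hc, fun j => (ha j).1, (ha 0).2⟩

theorem reachQuery_eq (v : Fin n) :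
    reachQuery (codeGame r S) (coreach (nearestTranspose (codeGame r S)) n v) =
      codeDigraph ⟨fun i j => (nearestDigraph r).Adj i j ∧
        Relation.ReflTransGen (nearestDigraph r).Adj v i⟩ := by
  rw [reachQuery, length_codeGame]
  refine map_range_eq_codeDigraph fun i j => ?_
  rw [Bool.and_eq_true, nearestBit_iff, coreach_nearestTranspose_iff]

theorem twoBinDecider_iff : twoBinDecider (codeGame r S) = true ↔
    ∀ i, (∃ w ∈ freePlayers r S, Relation.ReflTransGen (nearestDigraph r).Adj i w) ∨
      ReachesEvenCycle (nearestDigraph r) i := by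
  rw [twoBinDecider, length_codeGame]
  simp only [List.all_eq_true, List.any_eq_true, List.mem_range, Bool.and_eq_true,
    Bool.or_eq_true, decide_eq_true_iff]
  have key : ∀ v : Fin n,
      ((∃ u < n, (coreach (nearestTranspose (codeGame r S)) n v).getD u false = true ∧
          freeBit (codeGame r S) u = true) ∨
        enc (reachQuery (codeGame r S) (coreach (nearestTranspose (codeGame r S)) n v)) ∈
          EvenCycle.language) ↔
      ((∃ w ∈ freePlayers r S, Relation.ReflTransGen (nearestDigraph r).Adj v w) ∨
        ReachesEvenCycle (nearestDigraph r) v) := by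
    intro v
    rw [reachQuery_eq, enc_codeDigraph_mem_language, ← reachesEvenCycle_iff]
    refine or_congr ⟨?_, ?_⟩ Iff.rfl
    · rintro ⟨u, hu, h1, h2⟩
      lift u to Fin n using hu
      exact ⟨u, (freeBit_iff r S u).1 h2, (coreach_nearestTranspose_iff r S u v).1 h1⟩
    · rintro ⟨u, h2, h1⟩
      exact ⟨u, u.2, (coreach_nearestTranspose_iff r S u v).2 h1, (freeBit_iff r S u).2 h2⟩
  exact ⟨fun h v => (key v).1 (h v v.2), fun h v hv => (key ⟨v, hv⟩).2 (h ⟨v, hv⟩)⟩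

end

theorem twoBin_reducible_evenCycle : TwoBin.PolyTimeReducible EvenCycle :=
  .of_polyTime (code := fun I => codeGame I.game.nodePref I.interest) encode_eq
    PolyTime.twoBinDecider fun I =>
      (twoBinDecider_iff _ _).trans I.binary.exists_isEquilibrium_iff.symm

theorem mainTheorem5 :
    DecisionProblem.PolyTimeEquivalent EvenCycle TwoBin ∧
      ∀ (n : ℕ) (D : Digraph (Fin n)), 2 ≤ n → StronglyConnected D →
        (StableDigraph D ↔ HasEvenCycle D) := by
  exact ⟨⟨evenCycle_reducible_twoBin, twoBin_reducible_evenCycle⟩,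
    fun _ _ hn hD => stableDigraph_iff_hasEvenCycle hn hD⟩
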